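/- Let $\mathfrak{C}$ be a category with all finite limits, and let $\mathbf{Cat}(\mathfrak{C})$ be the category of internal categories $\mathcal{H} = (H_1 \rightrightarrows H_0)$ and internal functors $\Phi = (\Phi_0, \Phi_1)$ in $\mathfrak{C}$ (it has pullbacks, computed on objects and on arrows). An internal functor $\Phi\colon \mathcal{H} \to \mathcal{K}$ is \emph{fully faithful} if the square with horizontal maps $\Phi_1\colon H_1 \to K_1$ and $\Phi_0 \times \Phi_0\colon H_0 \times H_0 \to K_0 \times K_0$ and vertical maps $(s,t)$ (source and target) is a pullback. It is a \emph{discrete opfibration} if the square formed by $s\colon H_1 \to H_0$, $\Phi_1$, $\Phi_0$ and $s\colon K_1 \to K_0$ is a pullback. A morphism $f\colon X \to Y$ in a category with pullbacks is an \emph{effective descent morphism} if pullback along $f$, viewed as an internal functor from the internal category given by the kernel pair $X \times_Y X \rightrightarrows X$ to the categorically discrete internal category on $Y$, is an equivalence from the category of discrete opfibrations over (the discrete internal category on) $Y$ to the category of discrete opfibrations over the kernel pair of $f$ (morphisms being the internal functors over the base). \textbf{Lemma.} Let $\Phi\colon \mathcal{H} \to \mathcal{K}$ be an internal functor in $\mathfrak{C}$.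 If $\Phi$ is fully faithful and $\Phi_0$ is an effective descent morphism in $\mathfrak{C}$, then $\Phi$ is an effective descent morphism in $\mathbf{Cat}(\mathfrak{C})$, and $\Phi_1$ is an effective descent morphism in $\mathfrak{C}$. -/

import Mathlib

open CategoryTheory CategoryTheory.Limits

universe v u

section

attribute [local simp] pullback.lift_fst pullback.lift_snd pullback.lift_fst_assoc
  pullback.lift_snd_assoc

/-- An internal category in a category `C` with pullbacks. The composition `comp` takes its
arguments in diagrammatic order: it is defined on the pullback of `tgt` along `src`. -/
structure InternalCat (C : Type u) [Category.{v} C] [HasPullbacks C] where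
  /-- the object of objects -/
  obj : C
  /-- the object of arrows -/
  arr : C
  src : arr ⟶ obj
  tgt : arr ⟶ obj
  idt : obj ⟶ arr
  comp : pullback tgt src ⟶ arr
  idt_src : idt ≫ src = 𝟙 obj
  idt_tgt : idt ≫ tgt = 𝟙 obj
  comp_src : comp ≫ src = pullback.fst tgt src ≫ src
  comp_tgt : comp ≫ tgt = pullback.snd tgt src ≫ tgt
  idt_comp : pullback.lift (src ≫ idt) (𝟙 arr) (by simp [idt_tgt]) ≫ comp = 𝟙 arr
  comp_idt : pullback.lift (𝟙 arr) (tgt ≫ idt) (by simp [idt_src]) ≫ comp = 𝟙 arr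
  /-- Associativity, stated for all composable triples `(f, g, h)` of generalised elements of
  `arr`, that is, for all morphisms into the object of composable triples. -/
  assoc : ∀ {T : C} (f g h : T ⟶ arr) (hfg : f ≫ tgt = g ≫ src) (hgh : g ≫ tgt = h ≫ src),
    pullback.lift (pullback.lift f g hfg ≫ comp) h (by simp [comp_tgt, hgh]) ≫ comp =
      pullback.lift f (pullback.lift g h hgh ≫ comp) (by simp [comp_src, hfg]) ≫ comp

namespace InternalCat

variable {C : Type u} [Category.{v} C] [HasPullbacks C]

attribute [simp] idt_src idt_tgt comp_src comp_tgt idt_comp comp_idt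

@[simp] theorem idt_src_assoc (H : InternalCat C) {Z : C} (h : H.obj ⟶ Z) :
    H.idt ≫ H.src ≫ h = h := by rw [← Category.assoc, idt_src, Category.id_comp]

@[simp] theorem idt_tgt_assoc (H : InternalCat C) {Z : C} (h : H.obj ⟶ Z) :
    H.idt ≫ H.tgt ≫ h = h := by rw [← Category.assoc, idt_tgt, Category.id_comp]

/-- Internal functors: an action on objects and an action on arrows, commuting with sources,
targets, identities and composition. -/
@[ext]
structure Hom (H K : InternalCat C) where
  obj : H.obj ⟶ K.obj
  arr : H.arr ⟶ K.arr
  src : H.src ≫ obj = arr ≫ K.src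
  tgt : H.tgt ≫ obj = arr ≫ K.tgt
  idt : H.idt ≫ arr = obj ≫ K.idt
  comp : H.comp ≫ arr =
    pullback.lift (pullback.fst H.tgt H.src ≫ arr) (pullback.snd H.tgt H.src ≫ arr)
      (by rw [Category.assoc, Category.assoc, ← tgt, ← src, pullback.condition_assoc]) ≫ K.comp

/-- The category of internal categories and internal functors in `C`. -/
instance : Category (InternalCat C) where
  Hom := Hom
  id H :=
    { obj := 𝟙 _
      arr := 𝟙 _
      src := by simp
      tgt := by simp
      idt := by simp
      comp := by
        have : pullback.lift (pullback.fst H.tgt H.src ≫ 𝟙 _) (pullback.snd H.tgt H.src ≫ 𝟙 _)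
            (by simp [pullback.condition]) = 𝟙 _ := by
          apply pullback.hom_ext <;> simp
        rw [this]; simp }
  comp F G :=
    { obj := F.obj ≫ G.obj
      arr := F.arr ≫ G.arr
      src := by rw [← Category.assoc, F.src, Category.assoc, G.src, Category.assoc]
      tgt := by rw [← Category.assoc, F.tgt, Category.assoc, G.tgt, Category.assoc]
      idt := by rw [← Category.assoc, F.idt, Category.assoc, G.idt, Category.assoc]
      comp := by
        rw [← Category.assoc, F.comp, Category.assoc, G.comp, ← Category.assoc]
        congr 1
        apply pullback.hom_ext <;> simp }
  id_comp F := by apply Hom.ext <;> simp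
  comp_id F := by apply Hom.ext <;> simp
  assoc F G H := by apply Hom.ext <;> simp

@[ext]
theorem hom_ext {H K : InternalCat C} {F G : H ⟶ K} (h₀ : F.obj = G.obj) (h₁ : F.arr = G.arr) :
    F = G :=
  Hom.ext h₀ h₁

@[simp] theorem id_obj (H : InternalCat C) : Hom.obj (𝟙 H) = 𝟙 H.obj := rfl

@[simp] theorem id_arr (H : InternalCat C) : Hom.arr (𝟙 H) = 𝟙 H.arr := rfl

@[simp] theorem comp_obj {H K L : InternalCat C} (F : H ⟶ K) (G : K ⟶ L) :
    Hom.obj (F ≫ G) = F.obj ≫ G.obj := rfl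

@[simp] theorem comp_arr {H K L : InternalCat C} (F : H ⟶ K) (G : K ⟶ L) :
    Hom.arr (F ≫ G) = F.arr ≫ G.arr := rfl

/-- The functor sending an internal category to its object of objects. -/
@[simps]
def objFunctor (C : Type u) [Category.{v} C] [HasPullbacks C] : InternalCat C ⥤ C where
  obj H := H.obj
  map F := F.obj

/-- The functor sending an internal category to its object of arrows. -/
@[simps]
def arrFunctor (C : Type u) [Category.{v} C] [HasPullbacks C] : InternalCat C ⥤ C where
  obj H := H.arr
  map F := F.arr

/-- An internal functor `Φ : H ⟶ K` is fully faithful if the square formed by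
`Φ₁ : H₁ ⟶ K₁`, `Φ₀ × Φ₀ : H₀ × H₀ ⟶ K₀ × K₀` and the two maps `(s, t)` is a pullback. -/
def IsFullyFaithful [HasBinaryProducts C] {H K : InternalCat C} (Φ : H ⟶ K) : Prop :=
  IsPullback Φ.arr (prod.lift H.src H.tgt) (prod.lift K.src K.tgt) (prod.map Φ.obj Φ.obj)

/-- The class of discrete opfibrations: the internal functors `Φ : H ⟶ K` for which the square
formed by `s : H₁ ⟶ H₀`, `Φ₁`, `Φ₀` and `s : K₁ ⟶ K₀` is a pullback. -/
def discreteOpfibrations (C : Type u) [Category.{v} C] [HasPullbacks C] :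
    MorphismProperty (InternalCat C) :=
  fun H K Φ => IsPullback H.src Φ.arr Φ.obj K.src

/-- The categorically discrete internal category on an object. -/
noncomputable def discrete (Y : C) : InternalCat C where
  obj := Y
  arr := Y
  src := 𝟙 Y
  tgt := 𝟙 Y
  idt := 𝟙 Y
  comp := pullback.fst (𝟙 Y) (𝟙 Y)
  idt_src := by simp
  idt_tgt := by simp
  comp_src := rfl
  comp_tgt := pullback.condition
  idt_comp := by simp
  comp_idt := by simp
  assoc := by simp

/-- The kernel pair `X ×_Y X ⇉ X` of `f : X ⟶ Y`, as an internal category (an internal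
equivalence relation) with object of objects `X`. -/
noncomputable def kernelPair {X Y : C} (f : X ⟶ Y) : InternalCat C where
  obj := X
  arr := pullback f f
  src := pullback.fst f f
  tgt := pullback.snd f f
  idt := pullback.lift (𝟙 X) (𝟙 X) rfl
  comp := pullback.lift
    (pullback.fst (pullback.snd f f) (pullback.fst f f) ≫ pullback.fst f f)
    (pullback.snd (pullback.snd f f) (pullback.fst f f) ≫ pullback.snd f f)
    (by rw [Category.assoc, Category.assoc, pullback.condition, pullback.condition_assoc,
      pullback.condition])
  idt_src := by simp
  idt_tgt := by simp
  comp_src := by simp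
  comp_tgt := by simp
  idt_comp := by apply pullback.hom_ext <;> simp
  comp_idt := by apply pullback.hom_ext <;> simp
  assoc := by intros; apply pullback.hom_ext <;> simp

/-- The morphism `f : X ⟶ Y`, viewed as an internal functor from its kernel pair to the
categorically discrete internal category on `Y`. -/
noncomputable def kernelPairFunctor {X Y : C} (f : X ⟶ Y) : kernelPair f ⟶ discrete Y where
  obj := f
  arr := pullback.fst f f ≫ f
  src := by simp [kernelPair, discrete]
  tgt := by simp [kernelPair, discrete, pullback.condition]
  idt := by simp [kernelPair, discrete]
  comp := by
    dsimp only [kernelPair, discrete]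
    simp only [pullback.lift_fst_assoc, Category.assoc]
    exact (pullback.lift_fst _ _ _).symm

/-- The composite (in diagrammatic order) of two composable generalised arrows. -/
noncomputable def mul (H : InternalCat C) {T : C} (f g : T ⟶ H.arr) (w : f ≫ H.tgt = g ≫ H.src) :
    T ⟶ H.arr :=
  pullback.lift f g w ≫ H.comp

@[simp] theorem mul_src (H : InternalCat C) {T : C} (f g : T ⟶ H.arr)
    (w : f ≫ H.tgt = g ≫ H.src) : H.mul f g w ≫ H.src = f ≫ H.src := by simp [mul]

@[simp] theorem mul_tgt (H : InternalCat C) {T : C} (f g : T ⟶ H.arr)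
    (w : f ≫ H.tgt = g ≫ H.src) : H.mul f g w ≫ H.tgt = g ≫ H.tgt := by simp [mul]

theorem mul_congr (H : InternalCat C) {T : C} {f g f' g' : T ⟶ H.arr} (hf : f = f') (hg : g = g')
    (w : f ≫ H.tgt = g ≫ H.src) : H.mul f g w = H.mul f' g' (by rw [← hf, ← hg, w]) := by
  subst hf hg; rfl

theorem comp_mul (H : InternalCat C) {S T : C} (k : S ⟶ T) (f g : T ⟶ H.arr)
    (w : f ≫ H.tgt = g ≫ H.src) :
    k ≫ H.mul f g w = H.mul (k ≫ f) (k ≫ g) (by simp [w]) := by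
  rw [mul, mul, ← Category.assoc]
  congr 1
  apply pullback.hom_ext <;> simp

theorem mul_map {H K : InternalCat C} (F : H ⟶ K) {T : C} (f g : T ⟶ H.arr)
    (w : f ≫ H.tgt = g ≫ H.src) :
    H.mul f g w ≫ F.arr = K.mul (f ≫ F.arr) (g ≫ F.arr)
      (by rw [Category.assoc, Category.assoc, ← F.src, ← F.tgt, reassoc_of% w]) := by
  rw [mul, mul, Category.assoc, F.comp, ← Category.assoc]
  congr 1
  apply pullback.hom_ext <;> simp

theorem mul_mul (H : InternalCat C) {T : C} (f g h : T ⟶ H.arr)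
    (hfg : f ≫ H.tgt = g ≫ H.src) (hgh : g ≫ H.tgt = h ≫ H.src) :
    H.mul (H.mul f g hfg) h (by simp [hgh]) = H.mul f (H.mul g h hgh) (by simp [hfg]) :=
  H.assoc f g h hfg hgh

theorem idt_mul (H : InternalCat C) {T : C} (f : T ⟶ H.arr) :
    H.mul (f ≫ H.src ≫ H.idt) f (by simp) = f := by
  have h : H.mul (H.src ≫ H.idt) (𝟙 _) (by simp) = 𝟙 _ := H.idt_comp
  have := f ≫= h
  rw [comp_mul] at this
  exact (mul_congr H (by simp) (by simp) _).trans (this.trans (Category.comp_id f))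

theorem mul_idt (H : InternalCat C) {T : C} (f : T ⟶ H.arr) :
    H.mul f (f ≫ H.tgt ≫ H.idt) (by simp) = f := by
  have h : H.mul (𝟙 _) (H.tgt ≫ H.idt) (by simp) = 𝟙 _ := H.comp_idt
  have := f ≫= h
  rw [comp_mul] at this
  exact (mul_congr H (by simp) (by simp) _).trans (this.trans (Category.comp_id f))

section Pullback

variable {A B K : InternalCat C} (F : A ⟶ K) (G : B ⟶ K)

/-- The source map of the pullback of two internal functors. -/
noncomputable def fiberSrc : pullback F.arr G.arr ⟶ pullback F.obj G.obj :=
  pullback.lift (pullback.fst F.arr G.arr ≫ A.src) (pullback.snd F.arr G.arr ≫ B.src)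
    (by rw [Category.assoc, Category.assoc, F.src, G.src, pullback.condition_assoc])

/-- The target map of the pullback of two internal functors. -/
noncomputable def fiberTgt : pullback F.arr G.arr ⟶ pullback F.obj G.obj :=
  pullback.lift (pullback.fst F.arr G.arr ≫ A.tgt) (pullback.snd F.arr G.arr ≫ B.tgt)
    (by rw [Category.assoc, Category.assoc, F.tgt, G.tgt, pullback.condition_assoc])

/-- The identities of the pullback of two internal functors. -/
noncomputable def fiberIdt : pullback F.obj G.obj ⟶ pullback F.arr G.arr :=
  pullback.lift (pullback.fst F.obj G.obj ≫ A.idt) (pullback.snd F.obj G.obj ≫ B.idt)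
    (by rw [Category.assoc, Category.assoc, F.idt, G.idt, pullback.condition_assoc])

theorem fiber_w_fst {F : A ⟶ K} {G : B ⟶ K} {T : C} {f g : T ⟶ pullback F.arr G.arr}
    (w : f ≫ fiberTgt F G = g ≫ fiberSrc F G) :
    (f ≫ pullback.fst _ _) ≫ A.tgt = (g ≫ pullback.fst _ _) ≫ A.src := by
  simpa [fiberTgt, fiberSrc] using w =≫ pullback.fst F.obj G.obj

theorem fiber_w_snd {F : A ⟶ K} {G : B ⟶ K} {T : C} {f g : T ⟶ pullback F.arr G.arr}
    (w : f ≫ fiberTgt F G = g ≫ fiberSrc F G) :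
    (f ≫ pullback.snd _ _) ≫ B.tgt = (g ≫ pullback.snd _ _) ≫ B.src := by
  simpa [fiberTgt, fiberSrc] using w =≫ pullback.snd F.obj G.obj

/-- Composition in the pullback of two internal functors, computed componentwise. -/
noncomputable def fiberMul {T : C} (f g : T ⟶ pullback F.arr G.arr)
    (w : f ≫ fiberTgt F G = g ≫ fiberSrc F G) : T ⟶ pullback F.arr G.arr :=
  pullback.lift
    (A.mul (f ≫ pullback.fst _ _) (g ≫ pullback.fst _ _) (fiber_w_fst w))
    (B.mul (f ≫ pullback.snd _ _) (g ≫ pullback.snd _ _) (fiber_w_snd w))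
    (by
      rw [mul_map, mul_map]
      exact mul_congr K (by simp [pullback.condition]) (by simp [pullback.condition]) _)

theorem fiberMul_fst {T : C} (f g : T ⟶ pullback F.arr G.arr)
    (w : f ≫ fiberTgt F G = g ≫ fiberSrc F G) :
    fiberMul F G f g w ≫ pullback.fst F.arr G.arr =
      A.mul (f ≫ pullback.fst _ _) (g ≫ pullback.fst _ _) (fiber_w_fst w) :=
  pullback.lift_fst _ _ _

theorem fiberMul_snd {T : C} (f g : T ⟶ pullback F.arr G.arr)
    (w : f ≫ fiberTgt F G = g ≫ fiberSrc F G) :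
    fiberMul F G f g w ≫ pullback.snd F.arr G.arr =
      B.mul (f ≫ pullback.snd _ _) (g ≫ pullback.snd _ _) (fiber_w_snd w) :=
  pullback.lift_snd _ _ _

theorem fiberMul_src {T : C} (f g : T ⟶ pullback F.arr G.arr)
    (w : f ≫ fiberTgt F G = g ≫ fiberSrc F G) :
    fiberMul F G f g w ≫ fiberSrc F G = f ≫ fiberSrc F G := by
  apply pullback.hom_ext <;> simp [fiberMul, fiberSrc]

theorem fiberMul_tgt {T : C} (f g : T ⟶ pullback F.arr G.arr)
    (w : f ≫ fiberTgt F G = g ≫ fiberSrc F G) :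
    fiberMul F G f g w ≫ fiberTgt F G = g ≫ fiberTgt F G := by
  apply pullback.hom_ext <;> simp [fiberMul, fiberTgt]

theorem lift_fiberMul {T : C} (f g : T ⟶ pullback F.arr G.arr)
    (w : f ≫ fiberTgt F G = g ≫ fiberSrc F G) :
    pullback.lift f g w ≫ fiberMul F G (pullback.fst _ _) (pullback.snd _ _) pullback.condition =
      fiberMul F G f g w := by
  apply pullback.hom_ext
  · rw [Category.assoc, fiberMul_fst, fiberMul_fst, comp_mul]
    exact mul_congr A (pullback.lift_fst_assoc _ _ _ _) (pullback.lift_snd_assoc _ _ _ _) _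
  · rw [Category.assoc, fiberMul_snd, fiberMul_snd, comp_mul]
    exact mul_congr B (pullback.lift_fst_assoc _ _ _ _) (pullback.lift_snd_assoc _ _ _ _) _

/-- The pullback of two internal functors, computed on objects and on arrows. -/
noncomputable def fiberProduct : InternalCat C where
  obj := pullback F.obj G.obj
  arr := pullback F.arr G.arr
  src := fiberSrc F G
  tgt := fiberTgt F G
  idt := fiberIdt F G
  comp := fiberMul F G (pullback.fst _ _) (pullback.snd _ _) pullback.condition
  idt_src := by apply pullback.hom_ext <;> simp [fiberIdt, fiberSrc]
  idt_tgt := by apply pullback.hom_ext <;> simp [fiberIdt, fiberTgt]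
  comp_src := fiberMul_src F G _ _ _
  comp_tgt := fiberMul_tgt F G _ _ _
  idt_comp := by
    rw [lift_fiberMul]
    apply pullback.hom_ext
    · exact (fiberMul_fst F G _ _ _).trans <| (mul_congr A (by simp [fiberSrc, fiberIdt]) (by simp) _).trans
        ((A.idt_mul _).trans (Category.id_comp _).symm)
    · exact (fiberMul_snd F G _ _ _).trans <| (mul_congr B (by simp [fiberSrc, fiberIdt]) (by simp) _).trans
        ((B.idt_mul _).trans (Category.id_comp _).symm)
  comp_idt := by
    rw [lift_fiberMul]
    apply pullback.hom_ext
    · exact (fiberMul_fst F G _ _ _).trans <| (mul_congr A (by simp) (by simp [fiberTgt, fiberIdt]) _).trans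
        ((A.mul_idt _).trans (Category.id_comp _).symm)
    · exact (fiberMul_snd F G _ _ _).trans <| (mul_congr B (by simp) (by simp [fiberTgt, fiberIdt]) _).trans
        ((B.mul_idt _).trans (Category.id_comp _).symm)
  assoc {T} f g h hfg hgh := by
    simp only [lift_fiberMul]
    apply pullback.hom_ext
    · refine (fiberMul_fst F G _ _ _).trans (Eq.trans ?_ (fiberMul_fst F G _ _ _).symm)
      exact (mul_congr A (fiberMul_fst F G _ _ _) rfl _).trans
        ((A.mul_mul _ _ _ (fiber_w_fst hfg) (fiber_w_fst hgh)).trans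
          (mul_congr A rfl (fiberMul_fst F G _ _ _) _).symm)
    · refine (fiberMul_snd F G _ _ _).trans (Eq.trans ?_ (fiberMul_snd F G _ _ _).symm)
      exact (mul_congr B (fiberMul_snd F G _ _ _) rfl _).trans
        ((B.mul_mul _ _ _ (fiber_w_snd hfg) (fiber_w_snd hgh)).trans
          (mul_congr B rfl (fiberMul_snd F G _ _ _) _).symm)

/-- The first projection. -/
noncomputable def fiberProductFst : fiberProduct F G ⟶ A where
  obj := pullback.fst F.obj G.obj
  arr := pullback.fst F.arr G.arr
  src := pullback.lift_fst _ _ _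
  tgt := pullback.lift_fst _ _ _
  idt := pullback.lift_fst _ _ _
  comp := pullback.lift_fst _ _ _

/-- The second projection. -/
noncomputable def fiberProductSnd : fiberProduct F G ⟶ B where
  obj := pullback.snd F.obj G.obj
  arr := pullback.snd F.arr G.arr
  src := pullback.lift_snd _ _ _
  tgt := pullback.lift_snd _ _ _
  idt := pullback.lift_snd _ _ _
  comp := pullback.lift_snd _ _ _

/-- The universal internal functor into the pullback. -/
noncomputable def fiberProductLift {F : A ⟶ K} {G : B ⟶ K} {T : InternalCat C} (U : T ⟶ A) (V : T ⟶ B)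
    (w : U ≫ F = V ≫ G) : T ⟶ fiberProduct F G where
  obj := pullback.lift U.obj V.obj (congrArg Hom.obj w)
  arr := pullback.lift U.arr V.arr (congrArg Hom.arr w)
  src := by apply pullback.hom_ext <;> simp [fiberProduct, fiberSrc, U.src, V.src]
  tgt := by apply pullback.hom_ext <;> simp [fiberProduct, fiberTgt, U.tgt, V.tgt]
  idt := by apply pullback.hom_ext <;> simp [fiberProduct, fiberIdt, U.idt, V.idt]
  comp := by
    refine Eq.trans ?_ (lift_fiberMul F G _ _ _).symm
    apply pullback.hom_ext
    · refine Eq.trans ?_ (fiberMul_fst F G _ _ _).symm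
      have h₁ : T.comp ≫ U.arr = _ := U.comp
      have h₂ := pullback.lift_fst U.arr V.arr (congrArg Hom.arr w)
      refine ((Category.assoc _ _ _).trans (congrArg (T.comp ≫ ·) h₂)).trans (h₁.trans ?_)
      exact mul_congr A ((congrArg (pullback.fst T.tgt T.src ≫ ·) h₂).symm.trans
        (Category.assoc _ _ _).symm) ((congrArg (pullback.snd T.tgt T.src ≫ ·) h₂).symm.trans
        (Category.assoc _ _ _).symm) _
    · refine Eq.trans ?_ (fiberMul_snd F G _ _ _).symm
      have h₁ : T.comp ≫ V.arr = _ := V.comp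
      have h₂ := pullback.lift_snd U.arr V.arr (congrArg Hom.arr w)
      refine ((Category.assoc _ _ _).trans (congrArg (T.comp ≫ ·) h₂)).trans (h₁.trans ?_)
      exact mul_congr B ((congrArg (pullback.fst T.tgt T.src ≫ ·) h₂).symm.trans
        (Category.assoc _ _ _).symm) ((congrArg (pullback.snd T.tgt T.src ≫ ·) h₂).symm.trans
        (Category.assoc _ _ _).symm) _

theorem isPullback_fiberProduct :
    IsPullback (fiberProductFst F G) (fiberProductSnd F G) F G where
  w := by
    ext
    · exact pullback.condition
    · exact pullback.condition
  isLimit' := ⟨PullbackCone.IsLimit.mk _ (fun s => fiberProductLift s.fst s.snd s.condition)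
    (fun s => by
      ext
      · exact pullback.lift_fst _ _ _
      · exact pullback.lift_fst _ _ _)
    (fun s => by
      ext
      · exact pullback.lift_snd _ _ _
      · exact pullback.lift_snd _ _ _)
    (fun s m h₁ h₂ => by
      ext
      · apply pullback.hom_ext
        · exact (congrArg Hom.obj h₁).trans (pullback.lift_fst _ _ _).symm
        · exact (congrArg Hom.obj h₂).trans (pullback.lift_snd _ _ _).symm
      · apply pullback.hom_ext
        · exact (congrArg Hom.arr h₁).trans (pullback.lift_fst _ _ _).symm
        · exact (congrArg Hom.arr h₂).trans (pullback.lift_snd _ _ _).symm)⟩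

instance : PreservesLimit (cospan F G) (objFunctor C) :=
  (isPullback_fiberProduct F G).preservesLimit_cospan_iff.2 (IsPullback.of_hasPullback F.obj G.obj)

instance : PreservesLimit (cospan F G) (arrFunctor C) :=
  (isPullback_fiberProduct F G).preservesLimit_cospan_iff.2 (IsPullback.of_hasPullback F.arr G.arr)

instance : HasLimit (cospan F G) := (isPullback_fiberProduct F G).hasPullback

end Pullback

/-- Internal categories form a category with pullbacks. -/
instance : HasPullbacks (InternalCat C) := hasPullbacks_of_hasLimit_cospan _

/-- Discrete opfibrations are stable under pullback. -/
instance : (discreteOpfibrations C).IsStableUnderBaseChange where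
  of_isPullback {A B P K F G F' G'} sq hG := by
    have h₀ : IsPullback F'.obj G'.obj G.obj F.obj := sq.map (objFunctor C)
    have h₁ : IsPullback F'.arr G'.arr G.arr F.arr := sq.map (arrFunctor C)
    have hG : IsPullback B.src G.arr G.obj K.src := hG
    have h₂ := h₁.paste_horiz hG
    rw [← F'.src, ← F.src] at h₂
    exact h₂.of_right G'.src h₀

end InternalCat

/-- A morphism `f : X ⟶ Y` of a category with pullbacks is an effective descent morphism if
pullback along `f`, viewed as an internal functor from its kernel pair to the categorically
discrete internal category on `Y`, is an equivalence from the category of discrete opfibrations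
over (the categorically discrete internal category on) `Y` to the category of discrete
opfibrations over the kernel pair of `f`. Morphisms of discrete opfibrations are
all internal functors over the base. -/
def IsEffectiveDescent {D : Type u} [Category.{v} D] [HasPullbacks D] {X Y : D} (f : X ⟶ Y) :
    Prop :=
  (MorphismProperty.Over.pullback (InternalCat.discreteOpfibrations D) ⊤
    (InternalCat.kernelPairFunctor f)).IsEquivalence

/-! Descent data for a morphism `f`, as in the definition of effective descent, amount to relations
between generalised elements of an object over the domain of `f` that relate `a` to its transports.
In this form, `f` is an effective descent morphism precisely if it is a stable effective epimorphism
and every such relation is the kernel pair of a projection to an object over the codomain. This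
elementary property is stable under base change, composition and binary products, so it passes from
`Φ.obj` to `Φ.arr`, which is a base change of `Φ.obj × Φ.obj` when `Φ` is fully faithful.

A descent relation for `Φ` restricts to one for `Φ.obj` and one for `Φ.arr`, and these descend to
objects `B₀` and `B₁`. Since `Φ` is full, composable pairs and triples in `B₁` lift, locally, to
composable pairs and triples upstairs, so that the structure of an internal category descends along
with them. -/

section StableEffectiveEpi

variable {C : Type u} [Category.{v} C]

/-- The morphisms all of whose base changes are effective epimorphisms. They are the covers along
which constructions with generalised elements are made locally. -/
def stableEffectiveEpis (C : Type u) [Category.{v} C] : MorphismProperty C :=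
  MorphismProperty.universally fun _ _ f => EffectiveEpi f

namespace stableEffectiveEpis

theorem effectiveEpi {X Y : C} {f : X ⟶ Y} (hf : stableEffectiveEpis C f) : EffectiveEpi f :=
  MorphismProperty.universally_le _ f hf

theorem epi {X Y : C} {f : X ⟶ Y} (hf : stableEffectiveEpis C f) : Epi f :=
  have := effectiveEpi hf
  inferInstance

theorem of_isPullback {X Y A B : C} {f : X ⟶ Y} {α : A ⟶ X} {p : A ⟶ B} {b : B ⟶ Y}
    (hf : stableEffectiveEpis C f) (sq : IsPullback α p f b) : stableEffectiveEpis C p :=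
  (MorphismProperty.universally_isStableUnderBaseChange _).of_isPullback sq hf

theorem id (T : C) : stableEffectiveEpis C (𝟙 T) := by
  intro A B α b p sq
  have := sq.flip.isIso_snd_of_isIso
  infer_instance

variable [HasPullbacks C]

theorem exists_lift {X Y T : C} {f : X ⟶ Y} (hf : stableEffectiveEpis C f) (y : T ⟶ Y) :
    ∃ (S : C) (c : S ⟶ T) (x : S ⟶ X), stableEffectiveEpis C c ∧ x ≫ f = c ≫ y :=
  ⟨pullback f y, pullback.snd f y, pullback.fst f y,
    of_isPullback hf (.of_hasPullback f y), pullback.condition⟩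

theorem effectiveEpi_comp {X Y Z : C} {f : X ⟶ Y} {g : Y ⟶ Z} (hf : stableEffectiveEpis C f)
    (hg : EffectiveEpi g) : EffectiveEpi (f ≫ g) := by
  have := effectiveEpi hf
  have desc_invariant {W T : C} (e : X ⟶ W)
      (he : ∀ {T : C} (x x' : T ⟶ X), x ≫ f ≫ g = x' ≫ f ≫ g → x ≫ e = x' ≫ e)
      (e₁ : Y ⟶ W) (he₁ : f ≫ e₁ = e) (y y' : T ⟶ Y) (h : y ≫ g = y' ≫ g) :
      y ≫ e₁ = y' ≫ e₁ := by
    obtain ⟨S, c, x, hc, hx⟩ := exists_lift hf y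
    obtain ⟨S', c', x', hc', hx'⟩ := exists_lift hf (c ≫ y')
    have := epi hc
    have := epi hc'
    rw [← cancel_epi c, ← cancel_epi c', ← reassoc_of% hx, ← reassoc_of% hx', he₁,
      ← he (c' ≫ x) x' (by simp [reassoc_of% hx, reassoc_of% hx', h]), Category.assoc]
  have fac {W : C} (e : X ⟶ W)
      (he : ∀ {T : C} (x x' : T ⟶ X), x ≫ f ≫ g = x' ≫ f ≫ g → x ≫ e = x' ≫ e) :
      ∃ h : Z ⟶ W, (f ≫ g) ≫ h = e := by
    have he₁ := EffectiveEpi.fac f e fun x x' h => he x x' (by rw [reassoc_of% h])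
    exact ⟨EffectiveEpi.desc g _ (desc_invariant e he _ he₁), by
      rw [Category.assoc, EffectiveEpi.fac, he₁]⟩
  exact ⟨⟨{ desc := fun e he => (fac e he).choose
            fac := fun e he => (fac e he).choose_spec
            uniq := fun e he m hm => by
              rw [← cancel_epi (f ≫ g), hm, (fac e he).choose_spec] }⟩⟩

theorem comp {X Y Z : C} {f : X ⟶ Y} {g : Y ⟶ Z} (hf : stableEffectiveEpis C f)
    (hg : stableEffectiveEpis C g) : stableEffectiveEpis C (f ≫ g) := by
  intro A B α b p sq
  have hp : pullback.lift (α ≫ f) p (by simp [sq.w]) ≫ pullback.snd g b = p :=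
    pullback.lift_snd _ _ _
  rw [← hp] at sq ⊢
  have sq₂ := IsPullback.of_hasPullback g b
  exact effectiveEpi_comp
    (of_isPullback hf (sq.of_right (pullback.lift_fst _ _ _) sq₂.flip).flip)
    (effectiveEpi (of_isPullback hg sq₂))

theorem effectiveEpi_of_lift {A B S : C} {c : S ⟶ B} (hc : stableEffectiveEpis C c) (p : A ⟶ B)
    (k : S ⟶ A) (hk : k ≫ p = c) : EffectiveEpi p := by
  have := effectiveEpi hc
  have : Epi (pullback.snd c p) := epi (of_isPullback hc (.of_hasPullback c p))
  have : IsSplitEpi (pullback.fst c p) :=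
    ⟨⟨⟨pullback.lift (𝟙 S) k (by simp [hk]), pullback.lift_fst _ _ _⟩⟩⟩
  have : EffectiveEpi (pullback.snd c p ≫ p) := by
    rw [← pullback.condition]
    infer_instance
  exact effectiveEpi_of_effectiveEpi_epi_comp p (pullback.snd c p)

end stableEffectiveEpis

end StableEffectiveEpi

section Descent

variable {C : Type u} [Category.{v} C]

/-- A descent datum for `f : X ⟶ Y` on `α : A ⟶ X`, presented by the relation between
generalised elements of `A` that relates `a` to its transports: every element of `A` can be
transported, in a unique way, to any element of `X` in the same fibre of `f`. -/
structure DescentRelation {X Y A : C} (f : X ⟶ Y) (α : A ⟶ X) where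
  Rel ⦃T : C⦄ : (T ⟶ A) → (T ⟶ A) → Prop
  refl ⦃T : C⦄ (a : T ⟶ A) : Rel a a
  trans ⦃T : C⦄ {a a' a'' : T ⟶ A} : Rel a a' → Rel a' a'' → Rel a a''
  precomp ⦃S T : C⦄ (k : S ⟶ T) {a a' : T ⟶ A} : Rel a a' → Rel (k ≫ a) (k ≫ a')
  fiber_eq ⦃T : C⦄ {a a' : T ⟶ A} : Rel a a' → a ≫ α ≫ f = a' ≫ α ≫ f
  eq_of_rel ⦃T : C⦄ {a a' : T ⟶ A} : Rel a a' → a ≫ α = a' ≫ α → a = a'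
  exists_transport ⦃T : C⦄ (a : T ⟶ A) (x : T ⟶ X) :
    a ≫ α ≫ f = x ≫ f → ∃ a', Rel a a' ∧ a' ≫ α = x

namespace DescentRelation

variable {X Y A : C} {f : X ⟶ Y} {α : A ⟶ X} (d : DescentRelation f α)

theorem symm {T : C} {a a' : T ⟶ A} (h : d.Rel a a') : d.Rel a' a := by
  obtain ⟨b, hb, hbα⟩ := d.exists_transport a' (a ≫ α) (by simpa using (d.fiber_eq h).symm)
  rwa [d.eq_of_rel (d.trans h hb) hbα.symm]

section Transport

variable [HasPullbacks C]

theorem exists_graph :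
    ∃ t : pullback (α ≫ f) f ⟶ A,
      d.Rel (pullback.fst (α ≫ f) f) t ∧ t ≫ α = pullback.snd (α ≫ f) f :=
  d.exists_transport _ _ pullback.condition

/-- The universal transport morphism: it sends an element `a` of `A` and an element `x` of `X` in
the same fibre of `f` to the transport of `a` to `x`. -/
noncomputable def transport : pullback (α ≫ f) f ⟶ A := d.exists_graph.choose

theorem rel_transport : d.Rel (pullback.fst (α ≫ f) f) d.transport := d.exists_graph.choose_spec.1

@[simp] theorem transport_comp : d.transport ≫ α = pullback.snd (α ≫ f) f :=
  d.exists_graph.choose_spec.2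

theorem lift_transport {T : C} {a a' : T ⟶ A} (h : d.Rel a a') :
    pullback.lift a (a' ≫ α) (by simpa using d.fiber_eq h) ≫ d.transport = a' := by
  have ha := d.precomp (pullback.lift a (a' ≫ α) (by simpa using d.fiber_eq h)) d.rel_transport
  rw [pullback.lift_fst] at ha
  exact d.eq_of_rel (d.trans (d.symm ha) h)
    (by rw [Category.assoc, transport_comp, pullback.lift_snd])

theorem rel_iff_exists_transport {T : C} {a a' : T ⟶ A} :
    d.Rel a a' ↔ ∃ e, e ≫ pullback.fst (α ≫ f) f = a ∧ e ≫ d.transport = a' := by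
  refine ⟨fun h => ⟨_, pullback.lift_fst _ _ _, d.lift_transport h⟩, ?_⟩
  rintro ⟨e, rfl, rfl⟩
  exact d.precomp e d.rel_transport

theorem transport_jointly_mono {T : C} {e e' : T ⟶ pullback (α ≫ f) f}
    (h : e ≫ pullback.fst (α ≫ f) f = e' ≫ pullback.fst (α ≫ f) f)
    (ht : e ≫ d.transport = e' ≫ d.transport) : e = e' :=
  pullback.hom_ext h (by simpa using ht =≫ α)

end Transport

/-- A descent relation is effective if it is the kernel pair of the projection `p` of a pullback
square that exhibits `α` as the base change of some `b` along `f`. That elements with the same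
image under `p` are related is automatic. -/
def IsEffective : Prop :=
  ∃ (B : C) (b : B ⟶ Y) (p : A ⟶ B), IsPullback α p f b ∧
    ∀ ⦃T : C⦄ ⦃a a' : T ⟶ A⦄, d.Rel a a' → a ≫ p = a' ≫ p

theorem rel_of_comp_eq {B : C} {b : B ⟶ Y} {p : A ⟶ B} (sq : IsPullback α p f b)
    (hp : ∀ ⦃T : C⦄ ⦃a a' : T ⟶ A⦄, d.Rel a a' → a ≫ p = a' ≫ p) {T : C} {a a' : T ⟶ A}
    (h : a ≫ p = a' ≫ p) : d.Rel a a' := by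
  obtain ⟨a'', ha'', hα⟩ :=
    d.exists_transport a (a' ≫ α) (by simp [sq.w, reassoc_of% h])
  have : a'' = a' := sq.hom_ext hα (by rw [← hp ha'', h])
  rwa [← this]

theorem exists_desc (hf : stableEffectiveEpis C f) {B Z : C} {b : B ⟶ Y} {p : A ⟶ B}
    (sq : IsPullback α p f b) (hp : ∀ ⦃T : C⦄ ⦃a a' : T ⟶ A⦄, d.Rel a a' → a ≫ p = a' ≫ p)
    (e : A ⟶ Z) (he : ∀ ⦃T : C⦄ ⦃a a' : T ⟶ A⦄, d.Rel a a' → a ≫ e = a' ≫ e) :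
    ∃ g : B ⟶ Z, p ≫ g = e :=
  have := stableEffectiveEpis.effectiveEpi (stableEffectiveEpis.of_isPullback hf sq)
  ⟨_, EffectiveEpi.fac p e fun _ _ h => he (d.rel_of_comp_eq sq hp h)⟩

/-- The descent relation obtained by regarding a descent datum for a base change `g` of `f` as one
for `f`. -/
def ofIsPullback {P W : C} {u : P ⟶ X} {g : P ⟶ W} {y : W ⟶ Y} (sq : IsPullback u g f y)
    {β : A ⟶ P} (e : DescentRelation g β) : DescentRelation f (β ≫ u) where
  Rel := e.Rel
  refl := e.refl
  trans := e.trans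
  precomp := e.precomp
  fiber_eq _ _ _ h := by simpa [sq.w] using e.fiber_eq h =≫ y
  eq_of_rel _ _ _ h hu := e.eq_of_rel h
    (sq.hom_ext (by simpa using hu) (by simpa using e.fiber_eq h))
  exists_transport _ a x h := by
    obtain ⟨a', ha', hβ⟩ := e.exists_transport a (sq.lift x (a ≫ β ≫ g)
      (by simpa [sq.w] using h.symm)) (by simp)
    exact ⟨a', ha', by simp [reassoc_of% hβ]⟩

variable {Z : C} {g : Y ⟶ Z}

/-- The part of a descent relation for `f ≫ g` that transports elements along the fibres of `f`
only. -/
def restrict (e : DescentRelation (f ≫ g) α) : DescentRelation f α where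
  Rel _ a a' := e.Rel a a' ∧ a ≫ α ≫ f = a' ≫ α ≫ f
  refl _ a := ⟨e.refl a, rfl⟩
  trans _ _ _ _ h h' := ⟨e.trans h.1 h'.1, h.2.trans h'.2⟩
  precomp _ _ k _ _ h := ⟨e.precomp k h.1, by simp [h.2]⟩
  fiber_eq _ _ _ h := h.2
  eq_of_rel _ _ _ h := e.eq_of_rel h.1
  exists_transport _ a x h := by
    obtain ⟨a', ha', hα⟩ := e.exists_transport a x (by simp [reassoc_of% h])
    exact ⟨a', ⟨ha', by rw [h, reassoc_of% hα]⟩, hα⟩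

theorem exists_transport_of_cover {B : C} {b : B ⟶ Y} {p : A ⟶ B}
    (e : DescentRelation (f ≫ g) α) (sq : IsPullback α p f b)
    (hp : ∀ ⦃T : C⦄ ⦃a a' : T ⟶ A⦄, e.restrict.Rel a a' → a ≫ p = a' ≫ p)
    {S T : C} {c : S ⟶ T} (hc : stableEffectiveEpis C c) {β : T ⟶ B} {y : T ⟶ Y}
    (h : β ≫ b ≫ g = y ≫ g) {a : S ⟶ A} (ha : a ≫ p = c ≫ β) {x : S ⟶ X} (hx : x ≫ f = c ≫ y) :
    ∃ (a' : S ⟶ A) (β' : T ⟶ B), e.Rel a a' ∧ a' ≫ p = c ≫ β' ∧ β' ≫ b = y := by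
  have := stableEffectiveEpis.effectiveEpi hc
  have := stableEffectiveEpis.epi hc
  obtain ⟨a', haa', ha'x⟩ := e.exists_transport a x (by
    rw [reassoc_of% sq.w, reassoc_of% ha, h, reassoc_of% hx])
  have ha'c {U : C} (k k' : U ⟶ S) (hk : k ≫ c = k' ≫ c) : k ≫ a' ≫ p = k' ≫ a' ≫ p := by
    have hka : e.Rel (k ≫ a) (k' ≫ a) :=
      (e.restrict.rel_of_comp_eq sq hp (by simp [ha, reassoc_of% hk])).1
    have hka' : e.Rel (k ≫ a') (k' ≫ a') :=
      e.trans (e.symm (e.precomp k haa')) (e.trans hka (e.precomp k' haa'))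
    simpa using hp ⟨hka', by simp [reassoc_of% ha'x, hx, reassoc_of% hk]⟩
  have fac := EffectiveEpi.fac c (a' ≫ p) ha'c
  refine ⟨a', EffectiveEpi.desc c (a' ≫ p) ha'c, haa', fac.symm, ?_⟩
  rw [← cancel_epi c, reassoc_of% fac, ← sq.w, reassoc_of% ha'x, hx]

/-- The relation induced on `B` by a descent relation for `f ≫ g` on `α`, when `A` descends along
`f` to `B`: two elements of `B` are related if they lift, after a cover, to related elements
of `A`. -/
def descend [HasPullbacks C] {B : C} {b : B ⟶ Y} {p : A ⟶ B} (e : DescentRelation (f ≫ g) α)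
    (hf : stableEffectiveEpis C f) (sq : IsPullback α p f b)
    (hp : ∀ ⦃T : C⦄ ⦃a a' : T ⟶ A⦄, e.restrict.Rel a a' → a ≫ p = a' ≫ p) :
    DescentRelation g b where
  Rel T β β' := ∃ (S : C) (c : S ⟶ T) (a a' : S ⟶ A), stableEffectiveEpis C c ∧ e.Rel a a' ∧
    a ≫ p = c ≫ β ∧ a' ≫ p = c ≫ β'
  refl T β := by
    obtain ⟨S, c, a, hc, ha⟩ :=
      stableEffectiveEpis.exists_lift (stableEffectiveEpis.of_isPullback hf sq) β
    exact ⟨S, c, a, a, hc, e.refl a, ha, ha⟩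
  trans T β β' β'' := by
    rintro ⟨S, c, a₁, a₂, hc, h, h₁, h₂⟩ ⟨S', c', a₃, a₄, hc', h', h₃, h₄⟩
    have h₂₃ : e.Rel (pullback.fst c c' ≫ a₂) (pullback.snd c c' ≫ a₃) :=
      (e.restrict.rel_of_comp_eq sq hp
        (by simp only [Category.assoc, h₂, h₃, pullback.condition_assoc])).1
    exact ⟨_, pullback.fst c c' ≫ c, pullback.fst c c' ≫ a₁, pullback.snd c c' ≫ a₄,
      stableEffectiveEpis.comp
        (stableEffectiveEpis.of_isPullback hc' (IsPullback.of_hasPullback c c').flip) hc,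
      e.trans (e.precomp _ h) (e.trans h₂₃ (e.precomp _ h')), by simp [h₁],
      by simp [h₄, pullback.condition_assoc]⟩
  precomp T T' k β β' := by
    rintro ⟨S, c, a, a', hc, h, ha, ha'⟩
    exact ⟨_, pullback.snd c k, pullback.fst c k ≫ a, pullback.fst c k ≫ a',
      stableEffectiveEpis.of_isPullback hc (.of_hasPullback c k), e.precomp _ h,
      by simp [ha, pullback.condition_assoc], by simp [ha', pullback.condition_assoc]⟩
  fiber_eq T β β' := by
    rintro ⟨S, c, a, a', hc, h, ha, ha'⟩
    have := stableEffectiveEpis.epi hc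
    rw [← cancel_epi c, ← reassoc_of% ha, ← reassoc_of% ha', ← reassoc_of% sq.w, e.fiber_eq h,
      reassoc_of% sq.w]
  eq_of_rel T β β' := by
    rintro ⟨S, c, a, a', hc, h, ha, ha'⟩ hb
    have := stableEffectiveEpis.epi hc
    rw [← cancel_epi c, ← ha, ← ha']
    exact hp ⟨h, by rw [sq.w, reassoc_of% ha, reassoc_of% ha', hb]⟩
  exists_transport T β y h := by
    obtain ⟨S, c, a, hc, ha⟩ :=
      stableEffectiveEpis.exists_lift (stableEffectiveEpis.of_isPullback hf sq) β
    obtain ⟨S', c', x, hc', hx⟩ := stableEffectiveEpis.exists_lift hf (c ≫ y)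
    have hcc' := stableEffectiveEpis.comp hc' hc
    obtain ⟨a', β', haa', ha', hβ'⟩ := e.exists_transport_of_cover sq hp hcc' h
      (a := c' ≫ a) (by simp [ha]) (x := x) (by simp [hx])
    exact ⟨β', ⟨S', c' ≫ c, c' ≫ a, a', hcc', haa', by simp [ha], ha'⟩, hβ'⟩

end DescentRelation

theorem isPullback_prodMap_id {A B : C} [HasBinaryProducts C] (X : C) (f : A ⟶ B) :
    IsPullback prod.snd (prod.map (𝟙 X) f) f prod.snd :=
  (IsPullback.of_prod_fst_with_id f X).of_iso (prod.braiding A X) (Iso.refl A) (prod.braiding B X)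
    (Iso.refl B) (by simp [prod.lift_snd]) (by simp) (by simp) (by simp [prod.lift_snd])

/-- The elementary form of effective descent: `f` is a stable effective epimorphism along which
all descent data are effective. -/
structure HasEffectiveDescent {X Y : C} (f : X ⟶ Y) : Prop where
  stable : stableEffectiveEpis C f
  effective ⦃A : C⦄ ⦃α : A ⟶ X⦄ (d : DescentRelation f α) : d.IsEffective

namespace HasEffectiveDescent

variable {X Y : C} {f : X ⟶ Y}

theorem of_isPullback {P W : C} {u : P ⟶ X} {g : P ⟶ W} {y : W ⟶ Y}
    (hf : HasEffectiveDescent f) (sq : IsPullback u g f y) : HasEffectiveDescent g where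
  stable := stableEffectiveEpis.of_isPullback hf.stable sq
  effective A α d := by
    obtain ⟨B, b, p, sqB, hp⟩ := hf.effective (d.ofIsPullback sq)
    have := stableEffectiveEpis.epi (stableEffectiveEpis.of_isPullback hf.stable sqB)
    obtain ⟨w, hw⟩ := (d.ofIsPullback sq).exists_desc hf.stable sqB hp (α ≫ g) fun _ _ _ h =>
      d.fiber_eq h
    have hwy : w ≫ y = b := by
      rw [← cancel_epi p, reassoc_of% hw, ← sq.w, ← sqB.w, Category.assoc]
    rw [← hwy] at sqB
    exact ⟨B, w, p, sqB.of_right hw.symm sq, hp⟩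

theorem comp [HasPullbacks C] {Z : C} {g : Y ⟶ Z} (hf : HasEffectiveDescent f)
    (hg : HasEffectiveDescent g) : HasEffectiveDescent (f ≫ g) where
  stable := stableEffectiveEpis.comp hf.stable hg.stable
  effective A α d := by
    obtain ⟨B, b, p, sqB, hp⟩ := hf.effective d.restrict
    obtain ⟨E, e, q, sqE, hq⟩ := hg.effective (d.descend hf.stable sqB hp)
    refine ⟨E, e, p ≫ q, (sqB.flip.paste_horiz sqE.flip).flip, fun T a a' h => ?_⟩
    simpa using hq ⟨T, 𝟙 T, a, a', stableEffectiveEpis.id T, h, (Category.id_comp _).symm,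
      (Category.id_comp _).symm⟩

theorem prodMap [HasPullbacks C] [HasBinaryProducts C] {X' Y' : C} {g : X' ⟶ Y'}
    (hf : HasEffectiveDescent f) (hg : HasEffectiveDescent g) :
    HasEffectiveDescent (prod.map f g) := by
  have hf' : HasEffectiveDescent (prod.map f (𝟙 X')) :=
    hf.of_isPullback (.of_prod_fst_with_id f X')
  have hg' : HasEffectiveDescent (prod.map (𝟙 Y) g) :=
    hg.of_isPullback (isPullback_prodMap_id Y g)
  simpa using hf'.comp hg'

end HasEffectiveDescent

end Descent

namespace DescentRelation

variable {C D : Type*} [Category C] [Category D] [HasPullbacks C] {X Y A : C} {f : X ⟶ Y}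
  {α : A ⟶ X} (d : DescentRelation f α) (F : C ⥤ D)

theorem map_eq_of_rel [PreservesLimit (cospan (α ≫ f) f) F] {R : C} {T : D}
    (k : T ⟶ F.obj R) {u u' : R ⟶ A} (h : d.Rel u u')
    (hα : (k ≫ F.map u) ≫ F.map α = (k ≫ F.map u') ≫ F.map α) :
    k ≫ F.map u = k ≫ F.map u' := by
  have sq := (IsPullback.of_hasPullback (α ≫ f) f).map F
  have hlift : k ≫ F.map (pullback.lift (g := f) u (u ≫ α) (Category.assoc u α f).symm) =
      k ≫ F.map (pullback.lift u (u' ≫ α) (by simpa using d.fiber_eq h)) := by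
    apply sq.hom_ext
    · simp only [Category.assoc, ← F.map_comp, pullback.lift_fst]
    · simpa only [Category.assoc, ← F.map_comp, pullback.lift_snd] using hα
  simpa only [Category.assoc, ← F.map_comp, d.lift_transport h, d.lift_transport (d.refl u)]
    using hlift =≫ F.map d.transport

variable [∀ {X Y Z : C} (g : X ⟶ Z) (h : Y ⟶ Z), PreservesLimit (cospan g h) F]

/-- The image of a descent relation under a pullback-preserving functor `F`: two elements are
related if they are instances of the images of related elements. -/
def map : DescentRelation (F.map f) (F.map α) where
  Rel T a a' := ∃ (R : C) (k : T ⟶ F.obj R) (u u' : R ⟶ A),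
    d.Rel u u' ∧ k ≫ F.map u = a ∧ k ≫ F.map u' = a'
  refl T a := ⟨A, a, 𝟙 A, 𝟙 A, d.refl _, by simp, by simp⟩
  trans T a a' a'' := by
    rintro ⟨R, k, u, u', hu, rfl, rfl⟩ ⟨S, l, w, w', hw, hl, rfl⟩
    have sq := (IsPullback.of_hasPullback u' w).map F
    refine ⟨pullback u' w, sq.lift k l hl.symm, pullback.fst u' w ≫ u, pullback.snd u' w ≫ w',
      d.trans (d.precomp _ hu) ?_, by simp, by simp⟩
    rw [pullback.condition]
    exact d.precomp _ hw
  precomp S T k a a' := by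
    rintro ⟨R, l, u, u', hu, rfl, rfl⟩
    exact ⟨R, k ≫ l, u, u', hu, Category.assoc _ _ _, Category.assoc _ _ _⟩
  fiber_eq T a a' := by
    rintro ⟨R, k, u, u', hu, rfl, rfl⟩
    simp only [Category.assoc, ← F.map_comp, d.fiber_eq hu]
  eq_of_rel T a a' := by
    rintro ⟨R, k, u, u', hu, rfl, rfl⟩
    exact d.map_eq_of_rel F k hu
  exists_transport T a x h := by
    have sq := (IsPullback.of_hasPullback (α ≫ f) f).map F
    obtain ⟨e, rfl, rfl⟩ := sq.exists_lift a x (by rw [F.map_comp, h])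
    exact ⟨e ≫ F.map d.transport, ⟨_, e, _, _, d.rel_transport, rfl, rfl⟩,
      by rw [Category.assoc, ← F.map_comp, transport_comp]⟩

variable {F} in
theorem exists_map_transport_of_rel {T : D} {a a' : T ⟶ F.obj A} (h : (d.map F).Rel a a') :
    ∃ e : T ⟶ F.obj (pullback (α ≫ f) f),
      e ≫ F.map (pullback.fst (α ≫ f) f) = a ∧ e ≫ F.map d.transport = a' := by
  obtain ⟨R, k, u, u', hu, rfl, rfl⟩ := h
  obtain ⟨e, rfl, rfl⟩ := d.rel_iff_exists_transport.1 hu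
  exact ⟨k ≫ F.map e, by simp, by simp⟩

end DescentRelation

namespace InternalCat

variable {C : Type u} [Category.{v} C] [HasPullbacks C]

theorem src_map {H K : InternalCat C} (F : H ⟶ K) : H.src ≫ F.obj = F.arr ≫ K.src := Hom.src F

theorem tgt_map {H K : InternalCat C} (F : H ⟶ K) : H.tgt ≫ F.obj = F.arr ≫ K.tgt := Hom.tgt F

theorem idt_map {H K : InternalCat C} (F : H ⟶ K) : H.idt ≫ F.arr = F.obj ≫ K.idt := Hom.idt F

theorem comp_eq_mul (H : InternalCat C) :
    H.comp = H.mul (pullback.fst H.tgt H.src) (pullback.snd H.tgt H.src) pullback.condition := by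
  have : pullback.lift (pullback.fst H.tgt H.src) (pullback.snd H.tgt H.src)
      pullback.condition = 𝟙 _ :=
    pullback.hom_ext ((pullback.lift_fst _ _ _).trans (Category.id_comp _).symm)
      ((pullback.lift_snd _ _ _).trans (Category.id_comp _).symm)
  rw [mul, this, Category.id_comp]

/-- An internal functor from a morphism on objects and one on arrows, with preservation of
composites expressed in terms of generalised elements. -/
def homMk {H K : InternalCat C} (obj : H.obj ⟶ K.obj) (arr : H.arr ⟶ K.arr)
    (src : H.src ≫ obj = arr ≫ K.src) (tgt : H.tgt ≫ obj = arr ≫ K.tgt)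
    (idt : H.idt ≫ arr = obj ≫ K.idt)
    (mul : ∀ {T : C} (f g : T ⟶ H.arr) (w : f ≫ H.tgt = g ≫ H.src),
      H.mul f g w ≫ arr = K.mul (f ≫ arr) (g ≫ arr)
        (by rw [Category.assoc, Category.assoc, ← tgt, ← src, reassoc_of% w])) : H ⟶ K where
  obj := obj
  arr := arr
  src := src
  tgt := tgt
  idt := idt
  comp := by
    have := mul _ _ (pullback.condition (f := H.tgt) (g := H.src))
    rwa [← comp_eq_mul] at this

section IsPullback

variable {P A B K : InternalCat C} {U : P ⟶ A} {V : P ⟶ B} {F : A ⟶ K} {G : B ⟶ K}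

theorem isPullback_obj (sq : IsPullback U V F G) : IsPullback U.obj V.obj F.obj G.obj :=
  sq.map (objFunctor C)

theorem isPullback_arr (sq : IsPullback U V F G) : IsPullback U.arr V.arr F.arr G.arr :=
  sq.map (arrFunctor C)

theorem exists_lift_of_isPullback_obj_arr (h₀ : IsPullback U.obj V.obj F.obj G.obj)
    (h₁ : IsPullback U.arr V.arr F.arr G.arr) {T : InternalCat C} (S : T ⟶ A) (S' : T ⟶ B)
    (w : S ≫ F = S' ≫ G) : ∃ L : T ⟶ P, L ≫ U = S ∧ L ≫ V = S' := by
  have w₀ : S.obj ≫ F.obj = S'.obj ≫ G.obj := congrArg Hom.obj w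
  have w₁ : S.arr ≫ F.arr = S'.arr ≫ G.arr := congrArg Hom.arr w
  refine ⟨homMk (h₀.lift S.obj S'.obj w₀) (h₁.lift S.arr S'.arr w₁) ?_ ?_ ?_ ?_,
    hom_ext (h₀.lift_fst _ _ _) (h₁.lift_fst _ _ _),
    hom_ext (h₀.lift_snd _ _ _) (h₁.lift_snd _ _ _)⟩
  · apply h₀.hom_ext <;> simp [src_map]
  · apply h₀.hom_ext <;> simp [tgt_map]
  · apply h₁.hom_ext <;> simp [idt_map]
  · intro X f g hfg
    apply h₁.hom_ext
    · rw [Category.assoc, h₁.lift_fst, mul_map, mul_map]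
      exact mul_congr A (by simp) (by simp) _
    · rw [Category.assoc, h₁.lift_snd, mul_map, mul_map]
      exact mul_congr B (by simp) (by simp) _

theorem isPullback_of_obj_arr (h₀ : IsPullback U.obj V.obj F.obj G.obj)
    (h₁ : IsPullback U.arr V.arr F.arr G.arr) : IsPullback U V F G := by
  have lift (s : PullbackCone F G) :=
    exists_lift_of_isPullback_obj_arr h₀ h₁ s.fst s.snd s.condition
  choose l hlU hlV using lift
  refine ⟨⟨hom_ext h₀.w h₁.w⟩, ⟨PullbackCone.IsLimit.mk _ l hlU hlV fun s m hmU hmV => ?_⟩⟩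
  have hU := hmU.trans (hlU s).symm
  have hV := hmV.trans (hlV s).symm
  exact hom_ext (h₀.hom_ext (congrArg Hom.obj hU) (congrArg Hom.obj hV))
    (h₁.hom_ext (congrArg Hom.arr hU) (congrArg Hom.arr hV))

end IsPullback

/-- An internal category is thin if its arrows are determined by their source and target, that is,
if it is an internal preorder. -/
def IsThin (K : InternalCat C) : Prop :=
  ∀ ⦃T : C⦄ ⦃e e' : T ⟶ K.arr⦄, e ≫ K.src = e' ≫ K.src → e ≫ K.tgt = e' ≫ K.tgt → e = e'

/-- An internal preorder, from a reflexive and transitive pair of jointly monic morphisms. -/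
def ofJointlyMono {A R : C} (s t : R ⟶ A)
    (hst : ∀ ⦃T : C⦄ ⦃e e' : T ⟶ R⦄, e ≫ s = e' ≫ s → e ≫ t = e' ≫ t → e = e')
    (i : A ⟶ R) (hs : i ≫ s = 𝟙 A) (ht : i ≫ t = 𝟙 A) (m : pullback t s ⟶ R)
    (hms : m ≫ s = pullback.fst t s ≫ s) (hmt : m ≫ t = pullback.snd t s ≫ t) :
    InternalCat C where
  obj := A
  arr := R
  src := s
  tgt := t
  idt := i
  comp := m
  idt_src := hs
  idt_tgt := ht
  comp_src := hms
  comp_tgt := hmt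
  idt_comp := hst (by simp [hms, hs, pullback.lift_fst_assoc])
    (by simp [hmt, pullback.lift_snd_assoc])
  comp_idt := hst (by simp [hms, pullback.lift_fst_assoc])
    (by simp [hmt, ht, pullback.lift_snd_assoc])
  assoc _ _ _ _ _ :=
    hst (by simp [hms, pullback.lift_fst_assoc]) (by simp [hmt, pullback.lift_snd_assoc])

theorem isThin_of_isKernelPair {R : InternalCat C} {Y : C} {f : R.obj ⟶ Y}
    (hR : IsKernelPair f R.src R.tgt) : R.IsThin :=
  fun _ _ _ hs ht => IsPullback.hom_ext hR hs ht

theorem isThin_of_isIso_src (E : InternalCat C) [IsIso E.src] : E.IsThin :=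
  fun _ _ _ hs _ => (cancel_mono E.src).1 hs

/-- A morphism of graphs into a thin internal category is an internal functor. -/
def homOfIsThin {Q K : InternalCat C} (hK : K.IsThin) (obj : Q.obj ⟶ K.obj) (arr : Q.arr ⟶ K.arr)
    (src : Q.src ≫ obj = arr ≫ K.src) (tgt : Q.tgt ≫ obj = arr ≫ K.tgt) : Q ⟶ K :=
  homMk obj arr src tgt (hK (by simp [← src]) (by simp [← tgt])) fun f g w =>
    hK (by rw [mul_src, Category.assoc, Category.assoc, ← src, ← Category.assoc, mul_src,
        Category.assoc])
      (by rw [mul_tgt, Category.assoc, Category.assoc, ← tgt, ← Category.assoc, mul_tgt,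
        Category.assoc])

/-- Two generalised objects are connected if there is an arrow from the first to the second. -/
def Connected (Q : InternalCat C) {T : C} (a a' : T ⟶ Q.obj) : Prop :=
  ∃ e : T ⟶ Q.arr, e ≫ Q.src = a ∧ e ≫ Q.tgt = a'

section Discrete

instance (Y : C) : IsIso (discrete Y).src := inferInstanceAs (IsIso (𝟙 Y))

variable {E P : InternalCat C}

theorem isIso_src_of_discreteOpfibration {K : InternalCat C} [IsIso K.src] {a : E ⟶ K}
    (ha : discreteOpfibrations C a) : IsIso E.src :=
  IsPullback.isIso_fst_of_isIso ha

variable [IsIso E.src]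

theorem hom_ext_of_isIso_src {U V : P ⟶ E} (h : U.obj = V.obj) : U = V :=
  hom_ext h (by rw [← cancel_mono E.src, ← src_map, ← src_map, h])

theorem discreteOpfibrations_of_isIso_src [IsIso P.src] (U : P ⟶ E) : discreteOpfibrations C U :=
  IsPullback.of_horiz_isIso ⟨src_map U⟩

variable (E) in
theorem src_eq_tgt_of_isIso_src : E.src = E.tgt := by
  have h : E.src ≫ E.idt = 𝟙 E.arr := by rw [← cancel_mono E.src]; simp
  simpa using h =≫ E.tgt

theorem Connected.comp_obj_eq {T : C} {a a' : T ⟶ P.obj} (h : P.Connected a a') (U : P ⟶ E) :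
    a ≫ U.obj = a' ≫ U.obj := by
  obtain ⟨e, rfl, rfl⟩ := h
  rw [Category.assoc, Category.assoc, src_map, tgt_map, src_eq_tgt_of_isIso_src]

/-- The internal functor into an internal category all of whose arrows are identities given by a
morphism on objects that identifies sources with targets. -/
def homOfObj (g : P.obj ⟶ E.obj) (hg : P.src ≫ g = P.tgt ≫ g) : P ⟶ E :=
  homOfIsThin E.isThin_of_isIso_src g (P.src ≫ g ≫ E.idt) (by simp) (by simp [hg])

@[simp] theorem homOfObj_obj (g : P.obj ⟶ E.obj) (hg : P.src ≫ g = P.tgt ≫ g) :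
    (homOfObj g hg).obj = g := rfl

end Discrete

end InternalCat

section OverPullback

open MorphismProperty

variable {E : Type*} [Category* E] [HasPullbacks E] {P : MorphismProperty E}
  [P.IsStableUnderBaseChange] {X Y : E} {f : X ⟶ Y}

theorem overPullback_map_eq_iff {A B : P.Over ⊤ Y} {k : A ⟶ B}
    {w : (Over.pullback P ⊤ f).obj A ⟶ (Over.pullback P ⊤ f).obj B} :
    (Over.pullback P ⊤ f).map k = w ↔
      pullback.fst A.hom f ≫ k.left = w.left ≫ pullback.fst B.hom f := by
  have hk : ((Over.pullback P ⊤ f).map k).left ≫ pullback.fst B.hom f =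
      pullback.fst A.hom f ≫ k.left := pullback.lift_fst _ _ _
  refine ⟨fun h => by rw [← h, hk], fun h => Over.Hom.ext (pullback.hom_ext (hk.trans h) ?_)⟩
  exact (Over.w ((Over.pullback P ⊤ f).map k)).trans (Over.w w).symm

theorem overPullback_existsUnique_hom [(Over.pullback P ⊤ f).Full]
    [(Over.pullback P ⊤ f).Faithful] {A B Q : E} {a : A ⟶ Y} {b : B ⟶ Y} {u : Q ⟶ A} {c : Q ⟶ X}
    (ha : P a) (hb : P b) (sq : IsPullback u c a f) (w : Q ⟶ B) (hw : w ≫ b = u ≫ a) :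
    ∃! h : A ⟶ B, h ≫ b = a ∧ u ≫ h = w := by
  let A' : P.Over ⊤ Y := Over.mk ⊤ a ha
  let B' : P.Over ⊤ Y := Over.mk ⊤ b hb
  let w₀ : pullback a f ⟶ pullback b f := pullback.lift (sq.isoPullback.inv ≫ w)
    (pullback.snd a f) (by rw [Category.assoc, hw, sq.isoPullback_inv_fst_assoc,
      pullback.condition])
  let w' : (Over.pullback P ⊤ f).obj A' ⟶ (Over.pullback P ⊤ f).obj B' :=
    Over.homMk w₀ (pullback.lift_snd _ _ _) trivial
  have hw₀ : w₀ ≫ pullback.fst b f = sq.isoPullback.inv ≫ w := pullback.lift_fst _ _ _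
  have comp_eq_iff (h : A ⟶ B) : pullback.fst a f ≫ h = w₀ ≫ pullback.fst b f ↔ u ≫ h = w := by
    rw [hw₀, Iso.eq_inv_comp, sq.isoPullback_hom_fst_assoc]
  have map_eq_iff (k : A' ⟶ B') : (Over.pullback P ⊤ f).map k = w' ↔ u ≫ k.left = w :=
    overPullback_map_eq_iff.trans (comp_eq_iff k.left)
  obtain ⟨k, hk⟩ := (Over.pullback P ⊤ f).map_surjective w'
  refine ⟨k.left, ⟨Over.w k, (map_eq_iff k).1 hk⟩, fun l ⟨hlb, hlw⟩ => ?_⟩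
  have hl : (Over.pullback P ⊤ f).map (Over.homMk l hlb : A' ⟶ B') = w' := (map_eq_iff _).2 hlw
  exact congrArg (·.left) ((Over.pullback P ⊤ f).map_injective (hl.trans hk.symm))

theorem overPullback_exists_isPullback [(Over.pullback P ⊤ f).EssSurj] {Q : E} {c : Q ⟶ X}
    (hc : P c) : ∃ (A : E) (a : A ⟶ Y) (u : Q ⟶ A), P a ∧ IsPullback u c a f := by
  let A := (Over.pullback P ⊤ f).objPreimage (Over.mk ⊤ c hc)
  let e := (Over.pullback P ⊤ f).objObjPreimageIso (Over.mk ⊤ c hc)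
  let e' : pullback A.hom f ≅ Q := (Over.forget P ⊤ X ⋙ CategoryTheory.Over.forget X).mapIso e
  have he : e'.inv ≫ pullback.snd A.hom f = c := Over.w e.inv
  exact ⟨A.left, A.hom, e'.inv ≫ pullback.fst A.hom f, A.prop,
    (IsPullback.of_hasPullback A.hom f).of_iso e' (Iso.refl _) (Iso.refl _) (Iso.refl _)
      (by simp) (by simp [← he]) (by simp) (by simp)⟩

theorem overPullback_isEquivalence
    (existsUnique_hom : ∀ ⦃A B Q : E⦄ ⦃a : A ⟶ Y⦄ ⦃b : B ⟶ Y⦄ ⦃u : Q ⟶ A⦄ ⦃c : Q ⟶ X⦄, P a → P b →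
      IsPullback u c a f → ∀ w : Q ⟶ B, w ≫ b = u ≫ a → ∃! h : A ⟶ B, h ≫ b = a ∧ u ≫ h = w)
    (exists_isPullback : ∀ ⦃Q : E⦄ ⦃c : Q ⟶ X⦄, P c →
      ∃ (A : E) (a : A ⟶ Y) (u : Q ⟶ A), P a ∧ IsPullback u c a f) :
    (Over.pullback P ⊤ f).IsEquivalence where
  faithful := ⟨fun {A B k l} hkl => by
    have hl := overPullback_map_eq_iff.1 hkl.symm
    rw [← overPullback_map_eq_iff.1 rfl] at hl
    exact Over.Hom.ext ((existsUnique_hom A.prop B.prop (.of_hasPullback A.hom f) _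
      (by rw [Category.assoc]; exact congrArg _ (Over.w k))).unique
      ⟨Over.w k, rfl⟩ ⟨Over.w l, hl⟩)⟩
  full := ⟨fun {A B} k => by
    let k' : pullback A.hom f ⟶ pullback B.hom f := k.left
    have hk : k' ≫ pullback.snd B.hom f = pullback.snd A.hom f := Over.w k
    obtain ⟨l, ⟨hlA, hlk⟩, -⟩ := existsUnique_hom A.prop B.prop (.of_hasPullback A.hom f)
      (k' ≫ pullback.fst B.hom f) (by rw [Category.assoc, pullback.condition,
        reassoc_of% hk, pullback.condition])
    exact ⟨Over.homMk l hlA, overPullback_map_eq_iff.2 hlk⟩⟩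
  essSurj := ⟨fun c => by
    obtain ⟨A, a, u, ha, sq⟩ := exists_isPullback c.prop
    exact ⟨Over.mk ⊤ a ha, ⟨Over.isoMk sq.isoPullback.symm sq.isoPullback_inv_snd⟩⟩⟩

end OverPullback

namespace InternalCat

variable {C : Type u} [Category.{v} C] [HasPullbacks C]

section KernelPair

variable {R Q : InternalCat C} {c : Q ⟶ R}

/-- The descent relation of a discrete opfibration `c` over a kernel pair: an element of `Q.obj` is
transported along the arrows of `Q`. -/
def connectedDescentRelation {Y : C} {f : R.obj ⟶ Y} (hR : IsKernelPair f R.src R.tgt)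
    (hc : discreteOpfibrations C c) : DescentRelation f c.obj where
  Rel _ a a' := Q.Connected a a'
  refl _ a := ⟨a ≫ Q.idt, by simp, by simp⟩
  trans _ a a' a'' := by
    rintro ⟨e, rfl, he⟩ ⟨e', he', rfl⟩
    exact ⟨Q.mul e e' (he.trans he'.symm), mul_src _ _ _ _, mul_tgt _ _ _ _⟩
  precomp _ _ k a a' := by
    rintro ⟨e, rfl, rfl⟩
    exact ⟨k ≫ e, Category.assoc _ _ _, Category.assoc _ _ _⟩
  fiber_eq _ a a' := by
    rintro ⟨e, rfl, rfl⟩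
    simp only [Category.assoc, reassoc_of% src_map c, reassoc_of% tgt_map c, hR.w]
  eq_of_rel _ a a' := by
    rintro ⟨e, rfl, rfl⟩ h
    have he : e = e ≫ Q.src ≫ Q.idt := IsPullback.hom_ext hc (by simp)
      (isThin_of_isKernelPair hR (by simp [← src_map])
        (by simpa [← tgt_map] using h.symm))
    rw [he]
    simp
  exists_transport _ a x h := by
    have sq : IsPullback Q.src c.arr c.obj R.src := hc
    obtain ⟨r, hr_src, hr_tgt⟩ := hR.exists_lift (a ≫ c.obj) x (by simpa using h)
    obtain ⟨e, he_src, he_arr⟩ := sq.exists_lift a r hr_src.symm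
    exact ⟨e ≫ Q.tgt, ⟨e, he_src, rfl⟩, by
      rw [Category.assoc, tgt_map, reassoc_of% he_arr, hr_tgt]⟩

variable {K : InternalCat C} [IsIso K.src] {κ : R ⟶ K}

theorem existsUnique_hom_of_hasEffectiveDescent (hR : IsKernelPair κ.obj R.src R.tgt)
    (hκ : HasEffectiveDescent κ.obj) {A B : InternalCat C} {a : A ⟶ K} {b : B ⟶ K} {p : Q ⟶ A}
    (ha : discreteOpfibrations C a) (hb : discreteOpfibrations C b) (sq : IsPullback p c a κ)
    (w : Q ⟶ B) (hw : w ≫ b = p ≫ a) : ∃! h : A ⟶ B, h ≫ b = a ∧ p ≫ h = w := by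
  have := isIso_src_of_discreteOpfibration ha
  have := isIso_src_of_discreteOpfibration hb
  have hc : discreteOpfibrations C c := (discreteOpfibrations C).of_isPullback sq ha
  have sq₀ := (isPullback_obj sq).flip
  have hp := stableEffectiveEpis.of_isPullback hκ.stable sq₀
  have := stableEffectiveEpis.effectiveEpi hp
  have := stableEffectiveEpis.epi hp
  have hpw {T : C} (q q' : T ⟶ Q.obj) (h : q ≫ p.obj = q' ≫ p.obj) : q ≫ w.obj = q' ≫ w.obj :=
    ((connectedDescentRelation hR hc).rel_of_comp_eq sq₀ (fun _ _ _ hq => hq.comp_obj_eq p)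
      h).comp_obj_eq w
  have fac := EffectiveEpi.fac p.obj w.obj hpw
  refine ⟨homOfObj (EffectiveEpi.desc p.obj w.obj hpw) (by rw [src_eq_tgt_of_isIso_src]),
    ⟨hom_ext_of_isIso_src ?_, hom_ext_of_isIso_src fac⟩, ?_⟩
  · rw [← cancel_epi p.obj, comp_obj, homOfObj_obj, reassoc_of% fac]
    exact congrArg Hom.obj hw
  · rintro h' ⟨-, hh'⟩
    refine hom_ext_of_isIso_src ?_
    rw [← cancel_epi p.obj, homOfObj_obj, fac]
    exact congrArg Hom.obj hh'

theorem isPullback_of_isPullback_obj {A : InternalCat C} [IsIso A.src] {a : A ⟶ K} {p : Q ⟶ A}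
    (hc : discreteOpfibrations C c) (sq : IsPullback p.obj c.obj a.obj κ.obj)
    (w : p ≫ a = c ≫ κ) : IsPullback p c a κ := by
  have sq_src := IsPullback.paste_horiz hc sq
  rw [src_map, src_map] at sq_src
  exact isPullback_of_obj_arr sq
    (.of_right sq_src (congrArg Hom.arr w) (discreteOpfibrations_of_isIso_src a))

theorem exists_isPullback_of_hasEffectiveDescent (hR : IsKernelPair κ.obj R.src R.tgt)
    (hκ : HasEffectiveDescent κ.obj) (hc : discreteOpfibrations C c) :
    ∃ (A : InternalCat C) (a : A ⟶ K) (p : Q ⟶ A), discreteOpfibrations C a ∧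
      IsPullback p c a κ := by
  obtain ⟨B, b, p, sq, hp⟩ := hκ.effective (connectedDescentRelation hR hc)
  have hst : Q.src ≫ p = Q.tgt ≫ p := hp ⟨𝟙 Q.arr, Category.id_comp _, Category.id_comp _⟩
  let b' : discrete B ⟶ K := homOfObj b rfl
  let p' : Q ⟶ discrete B := homOfObj p hst
  exact ⟨discrete B, b', p', discreteOpfibrations_of_isIso_src b',
    isPullback_of_isPullback_obj hc sq.flip (hom_ext_of_isIso_src sq.flip.w)⟩

end KernelPair

end InternalCat

theorem isEffectiveDescent_of_hasEffectiveDescent {D : Type u} [Category.{v} D] [HasPullbacks D]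
    {X Y : D} {f : X ⟶ Y} (hf : HasEffectiveDescent f) : IsEffectiveDescent f :=
  have hR : IsKernelPair (InternalCat.kernelPairFunctor f).obj (InternalCat.kernelPair f).src
    (InternalCat.kernelPair f).tgt := IsPullback.of_hasPullback f f
  overPullback_isEquivalence
    (fun _ _ _ _ _ _ _ => InternalCat.existsUnique_hom_of_hasEffectiveDescent hR hf)
    (fun _ _ => InternalCat.exists_isPullback_of_hasEffectiveDescent hR hf)

namespace DescentRelation

open InternalCat

variable {C : Type u} [Category.{v} C] {X Y A : C} {f : X ⟶ Y} {α : A ⟶ X}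

/-- The canonical descent relation on a base change along `f`: two elements are related if the
projection `p` identifies them. -/
def ofBaseChange {B : C} {b : B ⟶ Y} {p : A ⟶ B} (sq : IsPullback α p f b) :
    DescentRelation f α where
  Rel _ a a' := a ≫ p = a' ≫ p
  refl _ _ := rfl
  trans _ _ _ _ := Eq.trans
  precomp _ _ k _ _ h := by simp [h]
  fiber_eq _ _ _ h := by rw [sq.w, reassoc_of% h]
  eq_of_rel _ _ _ h hα := sq.hom_ext hα h
  exists_transport _ a x h := by
    obtain ⟨a', ha'α, ha'p⟩ := sq.exists_lift x (a ≫ p) (by simpa [sq.w] using h.symm)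
    exact ⟨a', ha'p.symm, ha'α⟩

variable [HasPullbacks C] (d : DescentRelation f α)

/-- A descent relation as an internal preorder on `A`. -/
noncomputable def preorder : InternalCat C :=
  have hm := d.trans (d.precomp (pullback.fst d.transport (pullback.fst (α ≫ f) f)) d.rel_transport)
    (by rw [pullback.condition]; exact d.precomp _ d.rel_transport)
  ofJointlyMono (pullback.fst (α ≫ f) f) d.transport
    (fun _ _ _ => d.transport_jointly_mono)
    (pullback.lift (𝟙 A) (𝟙 A ≫ α) (by simp)) (pullback.lift_fst _ _ _)
    (d.lift_transport (d.refl (𝟙 A)))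
    (pullback.lift _ (_ ≫ α) (by simpa only [Category.assoc] using d.fiber_eq hm))
    (pullback.lift_fst _ _ _)
    (d.lift_transport hm)

theorem preorder_connected_iff {T : C} {a a' : T ⟶ A} :
    d.preorder.Connected a a' ↔ d.Rel a a' :=
  d.rel_iff_exists_transport.symm

/-- The projection of the internal preorder of a descent relation to the kernel pair. -/
noncomputable def preorderProj : d.preorder ⟶ kernelPair f :=
  have w : (pullback.fst (α ≫ f) f ≫ α) ≫ f = pullback.snd (α ≫ f) f ≫ f := by
    rw [Category.assoc, pullback.condition]
  homOfIsThin (isThin_of_isKernelPair (f := f) (IsPullback.of_hasPullback f f)) α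
    (pullback.lift (pullback.fst (α ≫ f) f ≫ α) (pullback.snd (α ≫ f) f) w)
    (pullback.lift_fst _ _ _).symm (d.transport_comp.trans (pullback.lift_snd _ _ _).symm)

theorem discreteOpfibrations_preorderProj : discreteOpfibrations C d.preorderProj := by
  have : IsPullback (pullback.lift (pullback.fst (α ≫ f) f ≫ α) (pullback.snd (α ≫ f) f)
      (by simp [pullback.condition])) (pullback.fst (α ≫ f) f) (pullback.fst f f) α :=
    .of_right (by rw [pullback.lift_snd]; exact (IsPullback.of_hasPullback (α ≫ f) f).flip)
      (pullback.lift_fst _ _ _) (IsPullback.of_hasPullback f f).flip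
  exact this.flip

theorem preorder_src_comp_eq {W : C} {e : A ⟶ W}
    (he : ∀ ⦃T : C⦄ ⦃a a' : T ⟶ A⦄, d.Rel a a' → a ≫ e = a' ≫ e) :
    d.preorder.src ≫ e = d.preorder.tgt ≫ e :=
  he d.rel_transport

end DescentRelation

section IsEffectiveDescent

variable {C : Type u} [Category.{v} C] [HasPullbacks C] {X Y : C} {f : X ⟶ Y}

open InternalCat

theorem IsEffectiveDescent.isEffective (hf : IsEffectiveDescent f) {A : C} {α : A ⟶ X}
    (d : DescentRelation f α) : d.IsEffective := by
  have : (MorphismProperty.Over.pullback (discreteOpfibrations C) ⊤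
    (kernelPairFunctor f)).IsEquivalence := hf
  obtain ⟨B, b, p, hb, sq⟩ := overPullback_exists_isPullback (f := kernelPairFunctor f)
    d.discreteOpfibrations_preorderProj
  have := isIso_src_of_discreteOpfibration hb
  exact ⟨B.obj, b.obj, p.obj, (isPullback_obj sq).flip, fun _ _ _ h =>
    (d.preorder_connected_iff.2 h).comp_obj_eq p⟩

theorem IsEffectiveDescent.existsUnique_desc_over (hf : IsEffectiveDescent f) {A B V : C}
    {α : A ⟶ X} {p : A ⟶ B} {b : B ⟶ Y} (sq : IsPullback α p f b) (y : V ⟶ Y) (v : A ⟶ V)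
    (hv : ∀ ⦃T : C⦄ ⦃a a' : T ⟶ A⦄, a ≫ p = a' ≫ p → a ≫ v = a' ≫ v) (hvy : v ≫ y = p ≫ b) :
    ∃! g : B ⟶ V, g ≫ y = b ∧ p ≫ g = v := by
  have : (MorphismProperty.Over.pullback (discreteOpfibrations C) ⊤
    (kernelPairFunctor f)).IsEquivalence := hf
  let d := DescentRelation.ofBaseChange sq
  let b' : discrete B ⟶ discrete Y := homOfObj b rfl
  let y' : discrete V ⟶ discrete Y := homOfObj y rfl
  let p' : d.preorder ⟶ discrete B := homOfObj p (d.preorder_src_comp_eq fun _ _ _ h => h)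
  let v' : d.preorder ⟶ discrete V := homOfObj v (d.preorder_src_comp_eq hv)
  have sq' : IsPullback p' d.preorderProj b' (kernelPairFunctor f) :=
    isPullback_of_isPullback_obj d.discreteOpfibrations_preorderProj sq.flip
      (hom_ext_of_isIso_src sq.flip.w)
  obtain ⟨g, ⟨hgy, hpg⟩, g_unique⟩ := overPullback_existsUnique_hom
    (discreteOpfibrations_of_isIso_src b') (discreteOpfibrations_of_isIso_src y') sq' v'
    (hom_ext_of_isIso_src hvy)
  refine ⟨g.obj, ⟨congrArg Hom.obj hgy, congrArg Hom.obj hpg⟩, fun k ⟨hky, hpk⟩ => ?_⟩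
  let k' : discrete B ⟶ discrete V := homOfObj k rfl
  exact congrArg Hom.obj (g_unique k' ⟨hom_ext_of_isIso_src hky, hom_ext_of_isIso_src hpk⟩)

theorem IsEffectiveDescent.existsUnique_desc [HasBinaryProducts C] (hf : IsEffectiveDescent f)
    {A B W : C} {α : A ⟶ X} {p : A ⟶ B} {b : B ⟶ Y} (sq : IsPullback α p f b) (e : A ⟶ W)
    (he : ∀ ⦃T : C⦄ ⦃a a' : T ⟶ A⦄, a ≫ p = a' ≫ p → a ≫ e = a' ≫ e) :
    ∃! g : B ⟶ W, p ≫ g = e := by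
  obtain ⟨g, ⟨-, hpg⟩, g_unique⟩ := hf.existsUnique_desc_over sq (prod.fst : Y ⨯ W ⟶ Y)
    (prod.lift (p ≫ b) e) (fun _ _ _ h => by simp [prod.comp_lift, reassoc_of% h, he h])
    (prod.lift_fst _ _)
  refine ⟨g ≫ prod.snd, (by simpa only [Category.assoc, prod.lift_snd] using hpg =≫ prod.snd),
    fun g' hg' => ?_⟩
  rw [← g_unique (prod.lift b g') ⟨prod.lift_fst _ _, by simp [prod.comp_lift, hg']⟩,
    prod.lift_snd]

theorem IsEffectiveDescent.hasEffectiveDescent [HasBinaryProducts C] (hf : IsEffectiveDescent f) :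
    HasEffectiveDescent f where
  stable _ _ _ _ _ sq :=
    ⟨⟨{ desc := fun e he => (hf.existsUnique_desc sq.flip e fun _ => he).choose
        fac := fun e he => (hf.existsUnique_desc sq.flip e fun _ => he).choose_spec.1
        uniq := fun e he => (hf.existsUnique_desc sq.flip e fun _ => he).choose_spec.2 }⟩⟩
  effective _ _ d := hf.isEffective d

end IsEffectiveDescent

namespace InternalCat

variable {C : Type u} [Category.{v} C] [HasPullbacks C]

/-- A morphism of graphs from an internal category is a full cover if it is full and a stable
effective epimorphism on vertices and on edges. Internal categories and functors descend along full
covers. -/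
structure IsFullCover (A : InternalCat C) {B₀ B₁ : C} (s t : B₁ ⟶ B₀) (p₀ : A.obj ⟶ B₀)
    (p₁ : A.arr ⟶ B₁) : Prop where
  src : A.src ≫ p₀ = p₁ ≫ s
  tgt : A.tgt ≫ p₀ = p₁ ≫ t
  stable_obj : stableEffectiveEpis C p₀
  stable_arr : stableEffectiveEpis C p₁
  exists_lift ⦃T : C⦄ (x y : T ⟶ A.obj) (k : T ⟶ B₁) : k ≫ s = x ≫ p₀ → k ≫ t = y ≫ p₀ →
    ∃ a : T ⟶ A.arr, a ≫ A.src = x ∧ a ≫ A.tgt = y ∧ a ≫ p₁ = k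

/-- The morphism `m` descends the composition of `A` along the morphism `p₁` from the arrows of `A`
to the edges of the graph `s, t : B₁ ⟶ B₀`. -/
def DescendsComp (A : InternalCat C) {B₀ B₁ : C} (s t : B₁ ⟶ B₀) (p₁ : A.arr ⟶ B₁)
    (m : pullback t s ⟶ B₁) : Prop :=
  ∀ ⦃T : C⦄ ⦃c : T ⟶ pullback t s⦄ ⦃a b : T ⟶ A.arr⦄ (hab : a ≫ A.tgt = b ≫ A.src),
    a ≫ p₁ = c ≫ pullback.fst t s → b ≫ p₁ = c ≫ pullback.snd t s →
      c ≫ m = A.mul a b hab ≫ p₁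

section FullCover

variable {A : InternalCat C} {B₀ B₁ : C} {s t : B₁ ⟶ B₀} {p₀ : A.obj ⟶ B₀} {p₁ : A.arr ⟶ B₁}

theorem DescendsComp.comp_lift {m : pullback t s ⟶ B₁} (hm : A.DescendsComp s t p₁ m) {S T : C}
    {c : S ⟶ T} {k l : T ⟶ B₁} (w : k ≫ t = l ≫ s) {a b : S ⟶ A.arr}
    (hab : a ≫ A.tgt = b ≫ A.src) (ha : a ≫ p₁ = c ≫ k) (hb : b ≫ p₁ = c ≫ l) :
    c ≫ pullback.lift k l w ≫ m = A.mul a b hab ≫ p₁ := by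
  rw [← Category.assoc]
  exact hm hab (by rw [Category.assoc, pullback.lift_fst, ha])
    (by rw [Category.assoc, pullback.lift_snd, hb])

namespace IsFullCover

theorem exists_lift_of_src (h : IsFullCover A s t p₀ p₁) {T : C} (x : T ⟶ A.obj) (k : T ⟶ B₁)
    (hx : k ≫ s = x ≫ p₀) :
    ∃ (S : C) (c : S ⟶ T) (a : S ⟶ A.arr), stableEffectiveEpis C c ∧ a ≫ A.src = c ≫ x ∧
      a ≫ p₁ = c ≫ k := by
  obtain ⟨S, c, y, hc, hy⟩ := stableEffectiveEpis.exists_lift h.stable_obj (k ≫ t)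
  obtain ⟨a, ha_src, -, hak⟩ := h.exists_lift (c ≫ x) y (c ≫ k) (by simp [hx]) (by simp [hy])
  exact ⟨S, c, a, hc, ha_src, hak⟩

theorem exists_lift_pair (h : IsFullCover A s t p₀ p₁) {T : C} (k l : T ⟶ B₁)
    (w : k ≫ t = l ≫ s) :
    ∃ (S : C) (c : S ⟶ T) (a b : S ⟶ A.arr), stableEffectiveEpis C c ∧
      a ≫ A.tgt = b ≫ A.src ∧ a ≫ p₁ = c ≫ k ∧ b ≫ p₁ = c ≫ l := by
  obtain ⟨S, c, a, hc, ha⟩ := stableEffectiveEpis.exists_lift h.stable_arr k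
  obtain ⟨S', c', b, hc', hb_src, hb⟩ := h.exists_lift_of_src (a ≫ A.tgt) (c ≫ l)
    (by rw [Category.assoc, ← w, Category.assoc, h.tgt, reassoc_of% ha])
  exact ⟨S', c' ≫ c, c' ≫ a, b, stableEffectiveEpis.comp hc' hc, by simp [hb_src], by simp [ha],
    by simp [hb]⟩

theorem exists_lift_triple (h : IsFullCover A s t p₀ p₁) {T : C} (k l n : T ⟶ B₁)
    (w : k ≫ t = l ≫ s) (w' : l ≫ t = n ≫ s) :
    ∃ (S : C) (c : S ⟶ T) (a b e : S ⟶ A.arr), stableEffectiveEpis C c ∧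
      a ≫ A.tgt = b ≫ A.src ∧ b ≫ A.tgt = e ≫ A.src ∧
      a ≫ p₁ = c ≫ k ∧ b ≫ p₁ = c ≫ l ∧ e ≫ p₁ = c ≫ n := by
  obtain ⟨S, c, a, b, hc, hab, ha, hb⟩ := h.exists_lift_pair k l w
  obtain ⟨S', c', e, hc', he_src, he⟩ := h.exists_lift_of_src (b ≫ A.tgt) (c ≫ n)
    (by rw [Category.assoc, ← w', Category.assoc, h.tgt, reassoc_of% hb])
  exact ⟨S', c' ≫ c, c' ≫ a, c' ≫ b, e, stableEffectiveEpis.comp hc' hc, by simp [hab],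
    by simp [he_src], by simp [ha], by simp [hb], by simp [he]⟩

theorem exists_descendsComp (h : IsFullCover A s t p₀ p₁)
    (hcompat : ∀ ⦃T : C⦄ ⦃a b a' b' : T ⟶ A.arr⦄ (w : a ≫ A.tgt = b ≫ A.src)
      (w' : a' ≫ A.tgt = b' ≫ A.src), a ≫ p₁ = a' ≫ p₁ → b ≫ p₁ = b' ≫ p₁ →
        A.mul a b w ≫ p₁ = A.mul a' b' w' ≫ p₁) :
    ∃ m : pullback t s ⟶ B₁, A.DescendsComp s t p₁ m := by
  let p₂ : pullback A.tgt A.src ⟶ pullback t s :=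
    pullback.lift (pullback.fst _ _ ≫ p₁) (pullback.snd _ _ ≫ p₁) (by
      rw [Category.assoc, ← h.tgt, pullback.condition_assoc, h.src, Category.assoc])
  have hp₂ {T : C} {c : T ⟶ pullback t s} {a b : T ⟶ A.arr} (hab : a ≫ A.tgt = b ≫ A.src)
      (ha : a ≫ p₁ = c ≫ pullback.fst t s) (hb : b ≫ p₁ = c ≫ pullback.snd t s) :
      pullback.lift a b hab ≫ p₂ = c := by
    apply pullback.hom_ext <;>
      simp [p₂, pullback.lift_fst, pullback.lift_snd, pullback.lift_fst_assoc,
        pullback.lift_snd_assoc, ha, hb]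
  obtain ⟨S, c, a, b, hc, hab, ha, hb⟩ := h.exists_lift_pair (pullback.fst t s) (pullback.snd t s)
    pullback.condition
  have : EffectiveEpi p₂ := stableEffectiveEpis.effectiveEpi_of_lift hc p₂ _ (hp₂ hab ha hb)
  have hp₂_compat {T : C} (a a' : T ⟶ pullback A.tgt A.src) (haa' : a ≫ p₂ = a' ≫ p₂) :
      a ≫ A.comp ≫ p₁ = a' ≫ A.comp ≫ p₁ := by
    rw [comp_eq_mul, ← Category.assoc, ← Category.assoc, comp_mul, comp_mul]
    apply hcompat
    · simpa [p₂, pullback.lift_fst] using haa' =≫ pullback.fst t s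
    · simpa [p₂, pullback.lift_snd] using haa' =≫ pullback.snd t s
  refine ⟨EffectiveEpi.desc p₂ (A.comp ≫ p₁) hp₂_compat, fun T c a b hab ha hb => ?_⟩
  rw [← hp₂ hab ha hb, Category.assoc, EffectiveEpi.fac, mul, Category.assoc]

variable {m : pullback t s ⟶ B₁}

theorem comp_src (h : IsFullCover A s t p₀ p₁) (hm : A.DescendsComp s t p₁ m) :
    m ≫ s = pullback.fst t s ≫ s := by
  obtain ⟨S, c, a, b, hc, hab, ha, hb⟩ := h.exists_lift_pair _ _
    (pullback.condition (f := t) (g := s))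
  have := stableEffectiveEpis.epi hc
  rw [← cancel_epi c, reassoc_of% hm hab ha hb, ← h.src, ← Category.assoc, mul_src,
    Category.assoc, h.src, reassoc_of% ha]

theorem comp_tgt (h : IsFullCover A s t p₀ p₁) (hm : A.DescendsComp s t p₁ m) :
    m ≫ t = pullback.snd t s ≫ t := by
  obtain ⟨S, c, a, b, hc, hab, ha, hb⟩ := h.exists_lift_pair _ _
    (pullback.condition (f := t) (g := s))
  have := stableEffectiveEpis.epi hc
  rw [← cancel_epi c, reassoc_of% hm hab ha hb, ← h.tgt, ← Category.assoc, mul_tgt,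
    Category.assoc, h.tgt, reassoc_of% hb]

theorem idt_comp (h : IsFullCover A s t p₀ p₁) (hm : A.DescendsComp s t p₁ m) {i : B₀ ⟶ B₁}
    (hi : p₀ ≫ i = A.idt ≫ p₁) (w : (s ≫ i) ≫ t = 𝟙 B₁ ≫ s) :
    pullback.lift (s ≫ i) (𝟙 B₁) w ≫ m = 𝟙 B₁ := by
  have := stableEffectiveEpis.epi h.stable_arr
  rw [← cancel_epi p₁, hm.comp_lift w (a := 𝟙 _ ≫ A.src ≫ A.idt) (b := 𝟙 _) (by simp)
    (by rw [Category.id_comp, Category.assoc, ← hi, reassoc_of% h.src]) (by simp), idt_mul]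
  simp

theorem comp_idt (h : IsFullCover A s t p₀ p₁) (hm : A.DescendsComp s t p₁ m) {i : B₀ ⟶ B₁}
    (hi : p₀ ≫ i = A.idt ≫ p₁) (w : 𝟙 B₁ ≫ t = (t ≫ i) ≫ s) :
    pullback.lift (𝟙 B₁) (t ≫ i) w ≫ m = 𝟙 B₁ := by
  have := stableEffectiveEpis.epi h.stable_arr
  rw [← cancel_epi p₁, hm.comp_lift w (a := 𝟙 _) (b := 𝟙 _ ≫ A.tgt ≫ A.idt) (by simp)
    (by simp) (by rw [Category.id_comp, Category.assoc, ← hi, reassoc_of% h.tgt]), mul_idt]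
  simp

theorem comp_assoc (h : IsFullCover A s t p₀ p₁) (hm : A.DescendsComp s t p₁ m) {T : C}
    {k l n : T ⟶ B₁} (hkl : k ≫ t = l ≫ s) (hln : l ≫ t = n ≫ s)
    (hkl_n : (pullback.lift k l hkl ≫ m) ≫ t = n ≫ s)
    (hk_ln : k ≫ t = (pullback.lift l n hln ≫ m) ≫ s) :
    pullback.lift (pullback.lift k l hkl ≫ m) n hkl_n ≫ m =
      pullback.lift k (pullback.lift l n hln ≫ m) hk_ln ≫ m := by
  obtain ⟨S, c, a, b, e, hc, hab, hbe, ha, hb, he⟩ := h.exists_lift_triple k l n hkl hln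
  have := stableEffectiveEpis.epi hc
  rw [← cancel_epi c,
    hm.comp_lift hkl_n (by rw [mul_tgt, hbe]) (hm.comp_lift hkl hab ha hb).symm he,
    hm.comp_lift hk_ln (by rw [mul_src, hab]) ha (hm.comp_lift hln hbe hb he).symm,
    mul_mul _ _ _ _ hab hbe]

variable {i : B₀ ⟶ B₁}

/-- The internal category structure descended along a full cover. -/
def descend (h : IsFullCover A s t p₀ p₁) (hi : p₀ ≫ i = A.idt ≫ p₁)
    (hm : A.DescendsComp s t p₁ m) : InternalCat C :=
  have := stableEffectiveEpis.epi h.stable_obj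
  have hs : i ≫ s = 𝟙 B₀ := by rw [← cancel_epi p₀, reassoc_of% hi, ← h.src]; simp
  have ht : i ≫ t = 𝟙 B₀ := by rw [← cancel_epi p₀, reassoc_of% hi, ← h.tgt]; simp
  { obj := B₀
    arr := B₁
    src := s
    tgt := t
    idt := i
    comp := m
    idt_src := hs
    idt_tgt := ht
    comp_src := h.comp_src hm
    comp_tgt := h.comp_tgt hm
    idt_comp := h.idt_comp hm hi (by simp [ht])
    comp_idt := h.comp_idt hm hi (by simp [hs])
    assoc _ _ _ hkl hln := h.comp_assoc hm hkl hln
      (by rw [Category.assoc, h.comp_tgt hm, pullback.lift_snd_assoc, hln])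
      (by rw [Category.assoc, h.comp_src hm, pullback.lift_fst_assoc, hkl]) }

/-- The internal functor to an internal category descended along a full cover. -/
def toDescend (h : IsFullCover A s t p₀ p₁) (hi : p₀ ≫ i = A.idt ≫ p₁)
    (hm : A.DescendsComp s t p₁ m) : A ⟶ h.descend hi hm :=
  homMk (K := h.descend hi hm) p₀ p₁ h.src h.tgt hi.symm fun _ _ hab =>
    (hm hab (pullback.lift_fst _ _ _).symm (pullback.lift_snd _ _ _).symm).symm

end IsFullCover

end FullCover

namespace IsFullCover

variable {A B : InternalCat C} {p : A ⟶ B}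

/-- Internal functors descend along a full cover as soon as they descend on objects and on
arrows. -/
def descHom (h : IsFullCover A B.src B.tgt p.obj p.arr) {Z : InternalCat C} {e : A ⟶ Z}
    (g₀ : B.obj ⟶ Z.obj) (g₁ : B.arr ⟶ Z.arr) (h₀ : p.obj ≫ g₀ = e.obj)
    (h₁ : p.arr ≫ g₁ = e.arr) : B ⟶ Z :=
  have := stableEffectiveEpis.epi h.stable_obj
  have := stableEffectiveEpis.epi h.stable_arr
  homMk g₀ g₁
    (by rw [← cancel_epi p.arr, ← Category.assoc, ← h.src, Category.assoc, h₀, reassoc_of% h₁,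
      src_map])
    (by rw [← cancel_epi p.arr, ← Category.assoc, ← h.tgt, Category.assoc, h₀, reassoc_of% h₁,
      tgt_map])
    (by rw [← cancel_epi p.obj, ← Category.assoc, ← idt_map, Category.assoc, h₁, reassoc_of% h₀,
      idt_map])
    fun k l w => by
      obtain ⟨S, c, a, b, hc, hab, ha, hb⟩ := h.exists_lift_pair k l w
      have := stableEffectiveEpis.epi hc
      have hk : a ≫ e.arr = c ≫ k ≫ g₁ := by rw [← h₁, reassoc_of% ha]
      have hl : b ≫ e.arr = c ≫ l ≫ g₁ := by rw [← h₁, reassoc_of% hb]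
      rw [← cancel_epi c, ← Category.assoc, comp_mul, comp_mul, mul_congr _ ha.symm hb.symm,
        ← mul_map p a b hab, Category.assoc]
      exact (congrArg (_ ≫ ·) h₁).trans ((mul_map e a b hab).trans (mul_congr _ hk hl _))

theorem epi (h : IsFullCover A B.src B.tgt p.obj p.arr) : Epi p where
  left_cancellation u v huv := by
    have := stableEffectiveEpis.epi h.stable_obj
    have := stableEffectiveEpis.epi h.stable_arr
    refine hom_ext ?_ ?_
    · rw [← cancel_epi p.obj]
      exact congrArg Hom.obj huv
    · rw [← cancel_epi p.arr]
      exact congrArg Hom.arr huv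

theorem exists_desc (h : IsFullCover A B.src B.tgt p.obj p.arr) {Z : InternalCat C} (e : A ⟶ Z)
    (he : pullback.fst p p ≫ e = pullback.snd p p ≫ e) : ∃ g : B ⟶ Z, p ≫ g = e := by
  have := stableEffectiveEpis.effectiveEpi h.stable_obj
  have := stableEffectiveEpis.effectiveEpi h.stable_arr
  have sq := IsPullback.of_hasPullback p p
  have he_obj {T : C} (x x' : T ⟶ A.obj) (hx : x ≫ p.obj = x' ≫ p.obj) :
      x ≫ e.obj = x' ≫ e.obj := by
    obtain ⟨k, rfl, rfl⟩ := (isPullback_obj sq).exists_lift x x' hx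
    simpa using k ≫= congrArg Hom.obj he
  have he_arr {T : C} (x x' : T ⟶ A.arr) (hx : x ≫ p.arr = x' ≫ p.arr) :
      x ≫ e.arr = x' ≫ e.arr := by
    obtain ⟨k, rfl, rfl⟩ := (isPullback_arr sq).exists_lift x x' hx
    simpa using k ≫= congrArg Hom.arr he
  have fac_obj := EffectiveEpi.fac p.obj e.obj he_obj
  have fac_arr := EffectiveEpi.fac p.arr e.arr he_arr
  exact ⟨h.descHom _ _ fac_obj fac_arr, hom_ext fac_obj fac_arr⟩

theorem effectiveEpi (h : IsFullCover A B.src B.tgt p.obj p.arr) : EffectiveEpi p := by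
  have := h.epi
  have exists_desc {Z : InternalCat C} (e : A ⟶ Z)
      (he : ∀ {T : InternalCat C} (x x' : T ⟶ A), x ≫ p = x' ≫ p → x ≫ e = x' ≫ e) :
      ∃ g : B ⟶ Z, p ≫ g = e :=
    h.exists_desc e (he _ _ pullback.condition)
  exact ⟨⟨{ desc := fun e he => (exists_desc e he).choose
            fac := fun e he => (exists_desc e he).choose_spec
            uniq := fun e he g hg => by
              rw [← cancel_epi p, hg, (exists_desc e he).choose_spec] }⟩⟩

end IsFullCover

end InternalCat

section MapRel

open InternalCat

variable {C : Type u} [Category.{v} C] [HasPullbacks C] {H K A : InternalCat C} {Φ : H ⟶ K}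
  {α : A ⟶ H}

namespace DescentRelation

variable (d : DescentRelation Φ α)

/-- The descent relation on objects induced by one for an internal functor. -/
def objRelation : DescentRelation Φ.obj α.obj := d.map (objFunctor C)

/-- The descent relation on arrows induced by one for an internal functor. -/
def arrRelation : DescentRelation Φ.arr α.arr := d.map (arrFunctor C)

variable {T : C}

theorem rel_comp_src {a a' : T ⟶ A.arr} (h : d.arrRelation.Rel a a') :
    d.objRelation.Rel (a ≫ A.src) (a' ≫ A.src) := by
  obtain ⟨R, (k : T ⟶ R.arr), u, u', hu, rfl, rfl⟩ := h
  have comp_src (v : R ⟶ A) : (k ≫ R.src) ≫ v.obj = (k ≫ v.arr) ≫ A.src := by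
    simp only [Category.assoc, src_map]
  exact ⟨R, k ≫ R.src, u, u', hu, comp_src u, comp_src u'⟩

theorem rel_comp_tgt {a a' : T ⟶ A.arr} (h : d.arrRelation.Rel a a') :
    d.objRelation.Rel (a ≫ A.tgt) (a' ≫ A.tgt) := by
  obtain ⟨R, (k : T ⟶ R.arr), u, u', hu, rfl, rfl⟩ := h
  have comp_tgt (v : R ⟶ A) : (k ≫ R.tgt) ≫ v.obj = (k ≫ v.arr) ≫ A.tgt := by
    simp only [Category.assoc, tgt_map]
  exact ⟨R, k ≫ R.tgt, u, u', hu, comp_tgt u, comp_tgt u'⟩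

theorem rel_comp_idt {x x' : T ⟶ A.obj} (h : d.objRelation.Rel x x') :
    d.arrRelation.Rel (x ≫ A.idt) (x' ≫ A.idt) := by
  obtain ⟨R, (k : T ⟶ R.obj), u, u', hu, rfl, rfl⟩ := h
  have comp_idt (v : R ⟶ A) : (k ≫ R.idt) ≫ v.arr = (k ≫ v.obj) ≫ A.idt := by
    simp only [Category.assoc, idt_map]
  exact ⟨R, k ≫ R.idt, u, u', hu, comp_idt u, comp_idt u'⟩

theorem rel_mul {a b a' b' : T ⟶ A.arr} (ha : d.arrRelation.Rel a a')
    (hb : d.arrRelation.Rel b b') (w : a ≫ A.tgt = b ≫ A.src)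
    (w' : a' ≫ A.tgt = b' ≫ A.src) :
    d.arrRelation.Rel (A.mul a b w) (A.mul a' b' w') := by
  obtain ⟨(k : T ⟶ (pullback (α ≫ Φ) Φ).arr), rfl, rfl⟩ := d.exists_map_transport_of_rel ha
  obtain ⟨(l : T ⟶ (pullback (α ≫ Φ) Φ).arr), rfl, rfl⟩ := d.exists_map_transport_of_rel hb
  have composable_iff (v : pullback (α ≫ Φ) Φ ⟶ A) :
      (k ≫ v.arr) ≫ A.tgt = (l ≫ v.arr) ≫ A.src ↔
        (k ≫ (pullback (α ≫ Φ) Φ).tgt) ≫ v.obj = (l ≫ (pullback (α ≫ Φ) Φ).src) ≫ v.obj := by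
    simp only [Category.assoc, src_map, tgt_map]
  have transport_comp_obj : d.transport.obj ≫ α.obj = (pullback.snd (α ≫ Φ) Φ).obj :=
    congrArg Hom.obj d.transport_comp
  have hkl : k ≫ (pullback (α ≫ Φ) Φ).tgt = l ≫ (pullback (α ≫ Φ) Φ).src := by
    apply (isPullback_obj (IsPullback.of_hasPullback (α ≫ Φ) Φ)).hom_ext
    · exact (composable_iff _).1 w
    · simpa only [Category.assoc, transport_comp_obj] using (composable_iff _).1 w' =≫ α.obj
  exact ⟨_, (pullback (α ≫ Φ) Φ).mul k l hkl, _, _, d.rel_transport, mul_map _ k l hkl,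
    mul_map _ k l hkl⟩

theorem exists_src_tgt_idt (h₀ : stableEffectiveEpis C Φ.obj) (h₁ : stableEffectiveEpis C Φ.arr)
    {B₀ B₁ : C} {p₀ : A.obj ⟶ B₀} {p₁ : A.arr ⟶ B₁} {b₀ : B₀ ⟶ K.obj} {b₁ : B₁ ⟶ K.arr}
    (sq₀ : IsPullback α.obj p₀ Φ.obj b₀)
    (sq₁ : IsPullback α.arr p₁ Φ.arr b₁)
    (hp₀ : ∀ ⦃T : C⦄ ⦃x x' : T ⟶ A.obj⦄, d.objRelation.Rel x x' → x ≫ p₀ = x' ≫ p₀)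
    (hp₁ : ∀ ⦃T : C⦄ ⦃a a' : T ⟶ A.arr⦄, d.arrRelation.Rel a a' → a ≫ p₁ = a' ≫ p₁) :
    ∃ (s t : B₁ ⟶ B₀) (i : B₀ ⟶ B₁),
      A.src ≫ p₀ = p₁ ≫ s ∧ A.tgt ≫ p₀ = p₁ ≫ t ∧ p₀ ≫ i = A.idt ≫ p₁ := by
  obtain ⟨s, hs⟩ := d.arrRelation.exists_desc h₁ sq₁ hp₁ (A.src ≫ p₀) fun _ _ _ h => by
    simpa only [Category.assoc] using hp₀ (d.rel_comp_src h)
  obtain ⟨t, ht⟩ := d.arrRelation.exists_desc h₁ sq₁ hp₁ (A.tgt ≫ p₀) fun _ _ _ h => by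
    simpa only [Category.assoc] using hp₀ (d.rel_comp_tgt h)
  obtain ⟨i, hi⟩ := d.objRelation.exists_desc h₀ sq₀ hp₀ (A.idt ≫ p₁) fun _ _ _ h => by
    simpa only [Category.assoc] using hp₁ (d.rel_comp_idt h)
  exact ⟨s, t, i, hs.symm, ht.symm, hi⟩

end DescentRelation

end MapRel

namespace InternalCat.IsFullyFaithful

variable {C : Type u} [Category.{v} C] [HasPullbacks C] [HasBinaryProducts C]
  {H K : InternalCat C} {Φ : H ⟶ K}

theorem exists_lift (hff : IsFullyFaithful Φ) {T : C} (x y : T ⟶ H.obj) (k : T ⟶ K.arr)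
    (hx : k ≫ K.src = x ≫ Φ.obj) (hy : k ≫ K.tgt = y ≫ Φ.obj) :
    ∃ h : T ⟶ H.arr, h ≫ H.src = x ∧ h ≫ H.tgt = y ∧ h ≫ Φ.arr = k := by
  have w : k ≫ prod.lift K.src K.tgt = prod.lift x y ≫ prod.map Φ.obj Φ.obj := by
    simp [prod.comp_lift, hx, hy]
  obtain ⟨h, rfl, hxy⟩ := IsPullback.exists_lift hff k (prod.lift x y) w
  exact ⟨h, by simpa [prod.lift_fst] using hxy =≫ prod.fst,
    by simpa [prod.lift_snd] using hxy =≫ prod.snd, rfl⟩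

theorem hasEffectiveDescent_arr (hff : IsFullyFaithful Φ) (h₀ : HasEffectiveDescent Φ.obj) :
    HasEffectiveDescent Φ.arr :=
  (h₀.prodMap h₀).of_isPullback (IsPullback.flip hff)

theorem isFullCover (hff : IsFullyFaithful Φ) {A : InternalCat C} {α : A ⟶ H} {B₀ B₁ : C}
    {p₀ : A.obj ⟶ B₀} {p₁ : A.arr ⟶ B₁} {b₀ : B₀ ⟶ K.obj} {b₁ : B₁ ⟶ K.arr}
    (h₀ : stableEffectiveEpis C Φ.obj) (h₁ : stableEffectiveEpis C Φ.arr)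
    (sq₀ : IsPullback α.obj p₀ Φ.obj b₀)
    (sq₁ : IsPullback α.arr p₁ Φ.arr b₁) {s t : B₁ ⟶ B₀} (hs : A.src ≫ p₀ = p₁ ≫ s)
    (ht : A.tgt ≫ p₀ = p₁ ≫ t) : IsFullCover A s t p₀ p₁ where
  src := hs
  tgt := ht
  stable_obj := stableEffectiveEpis.of_isPullback h₀ sq₀
  stable_arr := stableEffectiveEpis.of_isPullback h₁ sq₁
  exists_lift T x y k hx hy := by
    have := stableEffectiveEpis.epi (stableEffectiveEpis.of_isPullback h₁ sq₁)
    have hsb : s ≫ b₀ = b₁ ≫ K.src := by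
      rw [← cancel_epi p₁, ← reassoc_of% hs, ← sq₀.w, reassoc_of% src_map, src_map,
        reassoc_of% sq₁.w]
    have htb : t ≫ b₀ = b₁ ≫ K.tgt := by
      rw [← cancel_epi p₁, ← reassoc_of% ht, ← sq₀.w, reassoc_of% tgt_map, tgt_map,
        reassoc_of% sq₁.w]
    obtain ⟨h, h_src, h_tgt, h_arr⟩ := hff.exists_lift (x ≫ α.obj) (y ≫ α.obj) (k ≫ b₁)
      (by rw [Category.assoc, ← hsb, reassoc_of% hx, Category.assoc, sq₀.w])
      (by rw [Category.assoc, ← htb, reassoc_of% hy, Category.assoc, sq₀.w])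
    refine ⟨sq₁.lift h k h_arr, sq₀.hom_ext ?_ ?_, sq₀.hom_ext ?_ ?_, sq₁.lift_snd _ _ _⟩
    · rw [Category.assoc, src_map, ← h_src, sq₁.lift_fst_assoc]
    · rw [Category.assoc, hs, sq₁.lift_snd_assoc, hx]
    · rw [Category.assoc, tgt_map, ← h_tgt, sq₁.lift_fst_assoc]
    · rw [Category.assoc, ht, sq₁.lift_snd_assoc, hy]

theorem hasEffectiveDescent (hff : IsFullyFaithful Φ) (h₀ : HasEffectiveDescent Φ.obj) :
    HasEffectiveDescent Φ where
  stable _ _ _ _ _ sq :=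
    (hff.isFullCover h₀.stable (hff.hasEffectiveDescent_arr h₀).stable (isPullback_obj sq.flip)
      (isPullback_arr sq.flip) (src_map _) (tgt_map _)).effectiveEpi
  effective A α d := by
    have h₁ := hff.hasEffectiveDescent_arr h₀
    obtain ⟨B₀, b₀, p₀, sq₀, hp₀⟩ := h₀.effective d.objRelation
    obtain ⟨B₁, b₁, p₁, sq₁, hp₁⟩ := h₁.effective d.arrRelation
    obtain ⟨s, t, i, hs, ht, hi⟩ := d.exists_src_tgt_idt h₀.stable h₁.stable sq₀ sq₁ hp₀ hp₁
    have cover : IsFullCover A s t p₀ p₁ :=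
      hff.isFullCover h₀.stable h₁.stable sq₀ sq₁ hs ht
    have rel_arr {T : C} {a a' : T ⟶ A.arr} (h : a ≫ p₁ = a' ≫ p₁) :
        d.arrRelation.Rel a a' :=
      d.arrRelation.rel_of_comp_eq sq₁ hp₁ h
    obtain ⟨m, hm⟩ := cover.exists_descendsComp fun T a b a' b' w w' ha hb =>
      hp₁ (d.rel_mul (rel_arr ha) (rel_arr hb) w w')
    let p : A ⟶ cover.descend hi hm := cover.toDescend hi hm
    let b : cover.descend hi hm ⟶ K :=
      IsFullCover.descHom (p := p) cover (e := α ≫ Φ) b₀ b₁ sq₀.w.symm sq₁.w.symm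
    exact ⟨_, b, p, isPullback_of_obj_arr sq₀ sq₁, fun T a a' h => hom_ext
      (hp₀ ⟨T, 𝟙 _, a, a', h, Category.id_comp _, Category.id_comp _⟩)
      (hp₁ ⟨T, 𝟙 _, a, a', h, Category.id_comp _, Category.id_comp _⟩)⟩

end InternalCat.IsFullyFaithful

end

theorem mainTheorem6 {C : Type u} [Category.{v} C] [HasFiniteLimits C] {H K : InternalCat C}
    (Φ : H ⟶ K) (hff : InternalCat.IsFullyFaithful Φ) (h₀ : IsEffectiveDescent Φ.obj) :
    IsEffectiveDescent Φ ∧ IsEffectiveDescent Φ.arr := by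
  have h := h₀.hasEffectiveDescent
  exact ⟨isEffectiveDescent_of_hasEffectiveDescent (hff.hasEffectiveDescent h),
    isEffectiveDescent_of_hasEffectiveDescent (hff.hasEffectiveDescent_arr h)⟩
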